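/- Let $0<q<1$ be real and let $n\ge 1$ be an integer. Let $C(SU_q(2))$ be the universal unital $C^*$-algebra generated by two elements $\alpha,\beta$ subject to $$\alpha^*\alpha+\beta^*\beta=1,\quad \alpha\alpha^*+q^2\beta\beta^*=1,\quad \alpha\beta-q\beta\alpha=0,\quad \alpha\beta^*-q\beta^*\alpha=0,\quad \beta^*\beta=\beta\beta^*. \qquad (*)$$ Let $\mathcal H=\ell^2(\mathbb N_0)\otimes L^2(\mathbb R)$, where $\mathbb N_0=\{0,1,2,\dots\}$. On $\ell^2(\mathbb N_0)$ put $Qe_k=q^ke_k$, $Se_k=e_{k-1}$ for $k>0$ and $Se_0=0$. On $L^2(\mathbb R)$ let $R_{\mathbb R}$ and $R_{\mathbb R}^{1/n}$ be the multiplications by $e^{2\pi i x}$ and $e^{2\pi i x/n}$. Let $C(SU_q(2))$ act on $\mathcal H$ through the representation $\pi$ with $\pi(\alpha)=S\sqrt{1-Q^2}\otimes 1$ and $\pi(\beta)=Q\otimes R_{\mathbb R}$. For each $k\ge 0$ let $f_k:\mathbb R\to\mathbb R$ be a continuous function with $f_k(t)=0$ for $t\le q^{2k+1}$ and for $t\ge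 q^{2k-1}$, and $f_k(q^{2k})=1$. Let $p_k=f_k(\beta\beta^*)\in C(SU_q(2))$, and let $p_k\otimes R_{\mathbb R}^{1/n}$ denote the operator $\pi(p_k)(1\otimes R_{\mathbb R}^{1/n})$ on $\mathcal H$. Put $$\widetilde\beta=\sum_{k=0}^\infty (q^{1/n})^k\,p_k\otimes R_{\mathbb R}^{1/n},\qquad \widetilde{\widetilde\beta}=\sum_{k=0}^\infty q^k\,p_k\otimes R_{\mathbb R}^{1/n},$$ and let the covering algebra $C(SU_q(2))[\widetilde\beta]\subset B(\mathcal H)$ be the $C^*$-algebra generated by $\pi(C(SU_q(2)))$ and $\widetilde\beta$. Then both series converge in operator norm, $\widetilde{\widetilde\beta}\in C(SU_q(2))[\widetilde\beta]$, and the pair $(\pi(\alpha),\widetilde{\widetilde\beta})$ satisfies the relations $(*)$, with $\pi(\alpha)$ and $\widetilde{\widetilde\beta}$ in place of $\alpha$ and $\beta$. Moreover there is exactly one $*$-isomorphism $$C(SU_q(2))\xrightarrow{\ \cong\ }C(SU_q(2))[\widetilde\beta]\qquad\text{with}\qquad \alpha\mapsto\pi(\alpha),\quad \beta\mapsto\widetilde{\widetilde\beta}.$$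 In particular, the covering algebra is $*$-isomorphic to the base algebra. -/

import Mathlib

namespace QuantumSU2

noncomputable section

open scoped ENNReal

/-- The defining relations of `SU_q(2)` for a pair `(a, b)` in a unital C*-algebra. -/
structure Relations {A : Type*} [CStarAlgebra A] (q : ℝ) (a b : A) : Prop where
  star_mul_add : star a * a + star b * b = 1
  mul_star_add : a * star a + ((q : ℂ) ^ 2) • (b * star b) = 1
  comm : a * b - (q : ℂ) • (b * a) = 0
  comm_star : a * star b - (q : ℂ) • (star b * a) = 0
  normal : star b * b = b * star b

section Bound

open scoped CStarAlgebra

theorem norm_le_one_of_star_mul_add {A : Type*} [CStarAlgebra A] {x y : A}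
    (h : star x * x + star y * y = 1) : ‖x‖ ≤ 1 := by
  let _ := CStarAlgebra.spectralOrder A
  have := CStarAlgebra.spectralOrderedRing A
  have h1 : star x * x ≤ 1 := by
    rw [← h]
    exact le_add_of_nonneg_right (star_mul_self_nonneg y)
  have h2 : ‖star x * x‖ ≤ 1 :=
    (CStarAlgebra.norm_le_one_iff_of_nonneg _ (star_mul_self_nonneg x)).2 h1
  rw [CStarRing.norm_star_mul_self] at h2
  nlinarith [norm_nonneg x]

end Bound

theorem Relations.norm_left_le {A : Type*} [CStarAlgebra A] {q : ℝ} {a b : A}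
    (h : Relations q a b) : ‖a‖ ≤ 1 :=
  norm_le_one_of_star_mul_add h.star_mul_add

theorem Relations.norm_right_le {A : Type*} [CStarAlgebra A] {q : ℝ} {a b : A}
    (h : Relations q a b) : ‖b‖ ≤ 1 :=
  norm_le_one_of_star_mul_add ((add_comm _ _).trans h.star_mul_add)

/-- All realizations of the relations by pairs of elements of nonzero unital C*-algebras.
(A C*-algebra generated by two elements has at most the cardinality of the continuum, so algebras
whose underlying type lies in `Type` are enough.) -/
structure Realization (q : ℝ) : Type 1 where
  carrier : Type
  [cstar : CStarAlgebra carrier]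
  [nontriv : Nontrivial carrier]
  a : carrier
  b : carrier
  rel : Relations q a b

attribute [instance] Realization.cstar Realization.nontriv

instance instCStarAlgebraLp {I : Type*} {A : I → Type*} [∀ i, Nontrivial (A i)]
    [∀ i, CStarAlgebra (A i)] : CStarAlgebra (lp A ∞) where

/-- The bounded product of all realizations. -/
abbrev RealizationProduct (q : ℝ) : Type 1 :=
  lp (fun i : Realization q => i.carrier) ∞

/-- The element of the product whose coordinate at a realization `(B, a, b)` is `a`. -/
def prodA (q : ℝ) : RealizationProduct q :=
  ⟨fun i => i.a, memℓp_infty ⟨1, by rintro _ ⟨i, rfl⟩; exact i.rel.norm_left_le⟩⟩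

/-- The element of the product whose coordinate at a realization `(B, a, b)` is `b`. -/
def prodB (q : ℝ) : RealizationProduct q :=
  ⟨fun i => i.b, memℓp_infty ⟨1, by rintro _ ⟨i, rfl⟩; exact i.rel.norm_right_le⟩⟩

/-- The closed *-subalgebra of the product of all realizations generated by the two tautological
elements. -/
def algebra (q : ℝ) : StarSubalgebra ℂ (RealizationProduct q) :=
  (StarAlgebra.adjoin ℂ {prodA q, prodB q}).topologicalClosure

/-- `C(SU_q(2))`: the universal unital C*-algebra generated by two elements subject to the defining
relations. Its universal property is `existsUnique_lift`. -/
abbrev CSUq (q : ℝ) : Type 1 := algebra q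

instance (q : ℝ) : IsClosed (algebra q : Set (RealizationProduct q)) :=
  StarSubalgebra.isClosed_topologicalClosure _

/-- The generator `α` of `C(SU_q(2))`. -/
def alpha (q : ℝ) : CSUq q :=
  ⟨prodA q, StarSubalgebra.le_topologicalClosure _ (StarAlgebra.subset_adjoin ℂ _ (by simp))⟩

/-- The generator `β` of `C(SU_q(2))`. -/
def beta (q : ℝ) : CSUq q :=
  ⟨prodB q, StarSubalgebra.le_topologicalClosure _ (StarAlgebra.subset_adjoin ℂ _ (by simp))⟩

theorem relations (q : ℝ) : Relations q (alpha q) (beta q) where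
  star_mul_add := Subtype.ext (lp.ext (funext fun i => i.rel.star_mul_add))
  mul_star_add := Subtype.ext (lp.ext (funext fun i => i.rel.mul_star_add))
  comm := Subtype.ext (lp.ext (funext fun i => i.rel.comm))
  comm_star := Subtype.ext (lp.ext (funext fun i => i.rel.comm_star))
  normal := Subtype.ext (lp.ext (funext fun i => i.rel.normal))

open scoped CStarAlgebra in
theorem hom_ext {q : ℝ} {B : Type*} [CStarAlgebra B] {f g : CSUq q →⋆ₐ[ℂ] B}
    (ha : f (alpha q) = g (alpha q)) (hb : f (beta q) = g (beta q)) : f = g := by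
  have hf : Continuous f := map_continuous f
  have hg : Continuous g := map_continuous g
  refine StarAlgHom.ext_topologicalClosure hf hg (StarAlgHom.ext_adjoin ?_)
  rintro ⟨x, hx⟩ (rfl | rfl)
  · exact ha
  · exact hb

/-- The coordinate projection of `C(SU_q(2))` at a realization. -/
def eval {q : ℝ} (i : Realization q) : CSUq q →⋆ₐ[ℂ] i.carrier where
  toFun x := x.1 i
  map_one' := rfl
  map_mul' _ _ := rfl
  map_zero' := rfl
  map_add' _ _ := rfl
  commutes' _ := rfl
  map_star' _ := rfl

/-- The universal property of `C(SU_q(2))`. -/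
theorem existsUnique_lift {q : ℝ} {B : Type} [CStarAlgebra B] {a b : B} (h : Relations q a b) :
    ∃! f : CSUq q →⋆ₐ[ℂ] B, f (alpha q) = a ∧ f (beta q) = b := by
  cases subsingleton_or_nontrivial B
  · let z : CSUq q →⋆ₐ[ℂ] B :=
      { toFun := fun _ => 0
        map_one' := Subsingleton.elim _ _
        map_mul' := fun _ _ => Subsingleton.elim _ _
        map_zero' := rfl
        map_add' := fun _ _ => Subsingleton.elim _ _
        commutes' := fun _ => Subsingleton.elim _ _
        map_star' := fun _ => Subsingleton.elim _ _ }
    exact ⟨z, ⟨Subsingleton.elim _ _, Subsingleton.elim _ _⟩,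
      fun g _ => StarAlgHom.ext fun _ => Subsingleton.elim _ _⟩
  · exact ⟨eval ⟨B, a, b, h⟩, ⟨rfl, rfl⟩, fun g hg => hom_ext hg.1 hg.2⟩

/-- The *-homomorphism out of `C(SU_q(2))` that sends `α` to `a` and `β` to `b`. -/
def lift {q : ℝ} {B : Type} [CStarAlgebra B] {a b : B} (h : Relations q a b) :
    CSUq q →⋆ₐ[ℂ] B :=
  (existsUnique_lift h).choose

theorem lift_alpha {q : ℝ} {B : Type} [CStarAlgebra B] {a b : B} (h : Relations q a b) :
    lift h (alpha q) = a :=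
  (existsUnique_lift h).choose_spec.1.1

theorem lift_beta {q : ℝ} {B : Type} [CStarAlgebra B] {a b : B} (h : Relations q a b) :
    lift h (beta q) = b :=
  (existsUnique_lift h).choose_spec.1.2


open MeasureTheory
open scoped TensorProduct

/-- The Hilbert space `ℓ²(ℕ)`, `ℕ = {0, 1, 2, …}`. -/
abbrev EllTwo : Type := lp (fun _ : ℕ => ℂ) 2
/-- The Hilbert space `L²(ℝ)`. -/
abbrev LTwo : Type := Lp ℂ 2 (volume : Measure ℝ)

/-- The Hilbert space tensor product `ℓ²(ℕ) ⊗ L²(ℝ)`, the completion of the algebraic one. -/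
def Hilb : Type := UniformSpace.Completion (EllTwo ⊗[ℂ] LTwo)

instance : NormedAddCommGroup Hilb :=
  inferInstanceAs (NormedAddCommGroup (UniformSpace.Completion (EllTwo ⊗[ℂ] LTwo)))

instance : InnerProductSpace ℂ Hilb :=
  inferInstanceAs (InnerProductSpace ℂ (UniformSpace.Completion (EllTwo ⊗[ℂ] LTwo)))

instance : CompleteSpace Hilb :=
  inferInstanceAs (CompleteSpace (UniformSpace.Completion (EllTwo ⊗[ℂ] LTwo)))

/-- The inclusion of the algebraic tensor product. -/
def Hilb.of : EllTwo ⊗[ℂ] LTwo →ₗᵢ[ℂ] Hilb :=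
  UniformSpace.Completion.toComplₗᵢ (𝕜 := ℂ) (E := EllTwo ⊗[ℂ] LTwo)

theorem Hilb.denseRange_of : DenseRange Hilb.of :=
  UniformSpace.Completion.denseRange_coe (α := EllTwo ⊗[ℂ] LTwo)

/-- The bounded operator `A ⊗ B` on `ℓ²(ℕ) ⊗ L²(ℝ)`. -/
def tens (A : EllTwo →L[ℂ] EllTwo) (B : LTwo →L[ℂ] LTwo) : Hilb →L[ℂ] Hilb :=
  (TensorProduct.mapL A B).completion

theorem tens_of (A : EllTwo →L[ℂ] EllTwo) (B : LTwo →L[ℂ] LTwo) (x : EllTwo ⊗[ℂ] LTwo) :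
    tens A B (Hilb.of x) = Hilb.of (TensorProduct.mapL A B x) :=
  ContinuousLinearMap.completion_apply_coe (TensorProduct.mapL A B) x

theorem ext_of {T T' : Hilb →L[ℂ] Hilb} (h : ∀ x, T (Hilb.of x) = T' (Hilb.of x)) : T = T' :=
  DFunLike.coe_injective (Hilb.denseRange_of.equalizer T.continuous T'.continuous (funext h))

theorem tens_one : tens 1 1 = 1 :=
  ext_of fun x => by
    rw [tens_of, show TensorProduct.mapL (1 : EllTwo →L[ℂ] EllTwo) (1 : LTwo →L[ℂ] LTwo) = .id ℂ _
      from TensorProduct.mapL_id_id]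
    rfl

theorem tens_mul (A A' : EllTwo →L[ℂ] EllTwo) (B B' : LTwo →L[ℂ] LTwo) :
    tens A B * tens A' B' = tens (A * A') (B * B') :=
  ext_of fun x => by
    rw [mul_apply_eq_comp, tens_of, tens_of, tens_of, TensorProduct.mapL_mul]
    rfl

theorem tens_add_left (A A' : EllTwo →L[ℂ] EllTwo) (B : LTwo →L[ℂ] LTwo) :
    tens (A + A') B = tens A B + tens A' B :=
  ext_of fun x => by
    rw [add_apply, tens_of, tens_of, tens_of, TensorProduct.mapL_add_left, add_apply, map_add]

theorem tens_smul_left (c : ℂ) (A : EllTwo →L[ℂ] EllTwo) (B : LTwo →L[ℂ] LTwo) :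
    tens (c • A) B = c • tens A B :=
  ext_of fun x => by
    rw [smul_apply, tens_of, tens_of, TensorProduct.mapL_smul_left, smul_apply, map_smul]

theorem star_tens (A : EllTwo →L[ℂ] EllTwo) (B : LTwo →L[ℂ] LTwo) :
    star (tens A B) = tens (star A) (star B) := by
  have key : ∀ x y : EllTwo ⊗[ℂ] LTwo,
      inner ℂ (Hilb.of x) (tens A B (Hilb.of y)) =
        inner ℂ (tens (star A) (star B) (Hilb.of x)) (Hilb.of y) := by
    intro x y
    rw [tens_of, tens_of, LinearIsometry.inner_map_map, LinearIsometry.inner_map_map]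
    induction x with
    | zero => simp
    | add x x' hx hx' => simp only [map_add, inner_add_left, hx, hx']
    | tmul a b =>
      induction y with
      | zero => simp
      | add y y' hy hy' => simp only [map_add, inner_add_right, hy, hy']
      | tmul c d =>
        simp [ContinuousLinearMap.star_eq_adjoint, ContinuousLinearMap.adjoint_inner_left]
  symm
  rw [ContinuousLinearMap.star_eq_adjoint (tens A B), ContinuousLinearMap.eq_adjoint_iff]
  intro x y
  refine Hilb.denseRange_of.induction_on₂
    (p := fun x y => inner ℂ (tens (star A) (star B) x) y = inner ℂ x (tens A B y))
    (isClosed_eq (by fun_prop) (by fun_prop)) (fun x y => (key x y).symm) x y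

/-- The positive square root of a positive bounded operator. -/
def opSqrt {E : Type*} [NormedAddCommGroup E] [InnerProductSpace ℂ E] [CompleteSpace E]
    (T : E →L[ℂ] E) : E →L[ℂ] E :=
  CFC.sqrt T

theorem opSqrt_eq {E : Type*} [NormedAddCommGroup E] [InnerProductSpace ℂ E] [CompleteSpace E]
    {T b d : E →L[ℂ] E} (h : b * b = T) (hb : star d * d = b) : opSqrt T = b :=
  CFC.sqrt_unique h (hb ▸ star_mul_self_nonneg d)

/-- The diagonal operator `e_k ↦ c_k e_k` on `ℓ²(ℕ)`. -/
def diag (c : ℕ → ℂ) (hc : ∀ k, ‖c k‖ ≤ 1) : EllTwo →L[ℂ] EllTwo :=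
  lp.mapCLM 2 (fun k => c k • ContinuousLinearMap.id ℂ ℂ) zero_le_one
    (fun k => by simpa [norm_smul] using hc k)

theorem diag_apply (c : ℕ → ℂ) (hc : ∀ k, ‖c k‖ ≤ 1) (x : EllTwo) (k : ℕ) :
    diag c hc x k = c k * x k := rfl

/-- The operator `S e_k = e_{k-1}` for `k > 0`, `S e_0 = 0` (see `S_single_zero`, `S_single_succ`). -/
def S : EllTwo →L[ℂ] EllTwo :=
  LinearMap.mkContinuous
    { toFun := fun x => ⟨fun k => x (k + 1), memℓp_gen (((lp.memℓp x).summable (by simp)).comp_injective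
        (add_left_injective 1))⟩
      map_add' := fun _ _ => rfl
      map_smul' := fun _ _ => rfl }
    1 fun x => by
      refine lp.norm_le_of_tsum_le (by simp) (by positivity) ?_
      rw [one_mul, lp.norm_rpow_eq_tsum (by simp)]
      exact tsum_comp_le_tsum_of_inj ((lp.memℓp x).summable (by simp))
        (fun _ => by positivity) (add_left_injective 1)

theorem S_apply (x : EllTwo) (k : ℕ) : S x k = x (k + 1) := rfl

theorem S_single_zero (a : ℂ) : S (lp.single 2 0 a) = 0 :=
  lp.ext (funext fun k => by simp [S_apply, lp.single_apply])

theorem S_single_succ (k : ℕ) (a : ℂ) : S (lp.single 2 (k + 1) a) = lp.single 2 k a :=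
  lp.ext (funext fun j => by simp [S_apply, lp.single_apply, Pi.single_apply])

theorem star_apply (T : EllTwo →L[ℂ] EllTwo) (x : EllTwo) (k : ℕ) :
    star T x k = inner ℂ (T (lp.single 2 k 1)) x := by
  rw [← ContinuousLinearMap.adjoint_inner_right, lp.inner_single_left,
    ContinuousLinearMap.star_eq_adjoint]
  simp

theorem star_S_zero (x : EllTwo) : star S x 0 = 0 := by
  rw [star_apply, S_single_zero, inner_zero_left]

theorem star_S_succ (x : EllTwo) (k : ℕ) : star S x (k + 1) = x k := by
  rw [star_apply, S_single_succ, lp.inner_single_left]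
  simp

theorem diag_single (c : ℕ → ℂ) (hc : ∀ k, ‖c k‖ ≤ 1) (k : ℕ) :
    diag c hc (lp.single 2 k 1) = lp.single 2 k (c k) :=
  lp.ext (funext fun j => by
    rw [diag_apply, lp.single_apply, lp.single_apply]
    rcases eq_or_ne j k with rfl | h
    · simp
    · simp [h])

theorem star_diag (c : ℕ → ℝ) (hc : ∀ k, ‖(c k : ℂ)‖ ≤ 1) :
    star (diag (fun k => (c k : ℂ)) hc) = diag (fun k => (c k : ℂ)) hc := by
  ext1 x
  refine lp.ext (funext fun k => ?_)
  rw [star_apply, diag_single, lp.inner_single_left, diag_apply]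
  simp [mul_comm]

/-- The function `x ↦ exp (2 π i t x)`. -/
def phase (t : ℝ) (x : ℝ) : ℂ := Complex.exp (2 * Real.pi * Complex.I * t * x)

theorem norm_phase (t x : ℝ) : ‖phase t x‖ = 1 := by
  rw [phase, show 2 * (Real.pi : ℂ) * Complex.I * t * x = ((2 * Real.pi * t * x : ℝ) : ℂ) * Complex.I by
    push_cast; ring]
  exact Complex.norm_exp_ofReal_mul_I _

theorem continuous_phase (t : ℝ) : Continuous (phase t) := by
  unfold phase
  fun_prop

theorem memLp_phase_mul (t : ℝ) (f : LTwo) : MemLp (fun x => phase t x * f x) 2 volume :=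
  (Lp.memLp f).of_le ((continuous_phase t).aestronglyMeasurable.mul (Lp.aestronglyMeasurable f))
    (.of_forall fun x => by rw [norm_mul, norm_phase, one_mul])

/-- Multiplication by `x ↦ exp (2 π i t x)` on `L²(ℝ)`: `R_ℝ` is `phaseMul 1` and `R_ℝ^{1/n}` is
`phaseMul (1 / n)`. -/
def phaseMul (t : ℝ) : LTwo →L[ℂ] LTwo :=
  LinearMap.mkContinuous
    { toFun := fun f => (memLp_phase_mul t f).toLp
      map_add' := fun f g => by
        rw [← MemLp.toLp_add]
        refine MemLp.toLp_congr _ _ ?_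
        filter_upwards [Lp.coeFn_add f g] with x hx
        rw [hx, Pi.add_apply, Pi.add_apply, mul_add]
      map_smul' := fun c f => by
        rw [RingHom.id_apply, ← MemLp.toLp_const_smul]
        refine MemLp.toLp_congr _ _ ?_
        filter_upwards [Lp.coeFn_smul c f] with x hx
        rw [hx, Pi.smul_apply, Pi.smul_apply, smul_eq_mul, smul_eq_mul, mul_left_comm] }
    1 fun f => by
      rw [one_mul]
      refine Lp.norm_le_norm_of_ae_le ?_
      filter_upwards [MemLp.coeFn_toLp (memLp_phase_mul t f)] with x hx
      rw [LinearMap.coe_mk, AddHom.coe_mk, hx, norm_mul, norm_phase, one_mul]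

theorem coeFn_phaseMul (t : ℝ) (f : LTwo) :
    phaseMul t f =ᵐ[volume] fun x => phase t x * f x :=
  MemLp.coeFn_toLp (memLp_phase_mul t f)

theorem norm_phaseMul (t : ℝ) (f : LTwo) : ‖phaseMul t f‖ = ‖f‖ := by
  refine le_antisymm ?_ ?_ <;> refine Lp.norm_le_norm_of_ae_le ?_ <;>
  · filter_upwards [coeFn_phaseMul t f] with x hx
    rw [hx, norm_mul, norm_phase, one_mul]

theorem phaseMul_mul (s t : ℝ) : phaseMul s * phaseMul t = phaseMul (s + t) := by
  ext1 f
  refine Lp.ext ?_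
  filter_upwards [coeFn_phaseMul t f, coeFn_phaseMul s (phaseMul t f),
    coeFn_phaseMul (s + t) f] with x h1 h2 h3
  rw [mul_apply_eq_comp, h2, h1, h3, ← mul_assoc, phase, phase, phase, ← Complex.exp_add]
  push_cast
  ring_nf

theorem phaseMul_zero : phaseMul 0 = 1 := by
  ext1 f
  refine Lp.ext ?_
  filter_upwards [coeFn_phaseMul 0 f] with x h1
  rw [h1]
  simp [phase]

theorem star_phaseMul_mul (t : ℝ) : star (phaseMul t) * phaseMul t = 1 :=
  (ContinuousLinearMap.norm_map_iff_adjoint_comp_self _).1 (norm_phaseMul t)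

theorem phaseMul_mul_star (t : ℝ) : phaseMul t * star (phaseMul t) = 1 := by
  have h : phaseMul t * phaseMul (-t) = 1 := by
    rw [phaseMul_mul, add_neg_cancel, phaseMul_zero]
  have h2 : star (phaseMul t) = phaseMul (-t) := left_inv_eq_right_inv (star_phaseMul_mul t) h
  rw [h2, h]



theorem norm_pow_le {q : ℝ} (hq : q ∈ Set.Ioo (0 : ℝ) 1) (k : ℕ) : ‖((q ^ k : ℝ) : ℂ)‖ ≤ 1 := by
  rw [Complex.norm_real, Real.norm_eq_abs, abs_of_nonneg (pow_nonneg hq.1.le k)]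
  exact pow_le_one₀ hq.1.le hq.2.le

/-- The operator `Q e_k = q ^ k e_k` on `ℓ²(ℕ)`. -/
def Q {q : ℝ} (hq : q ∈ Set.Ioo (0 : ℝ) 1) : EllTwo →L[ℂ] EllTwo :=
  diag (fun k => ((q ^ k : ℝ) : ℂ)) (norm_pow_le hq)

theorem norm_sqrt_le {c : ℝ} (h1 : c ≤ 1) : ‖((√c : ℝ) : ℂ)‖ ≤ 1 := by
  rw [Complex.norm_real, Real.norm_eq_abs, abs_of_nonneg (Real.sqrt_nonneg _)]
  exact Real.sqrt_le_one.2 h1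

theorem diag_star_mul_sqrt (c : ℕ → ℝ) (h0 : ∀ k, 0 ≤ c k) (h1 : ∀ k, c k ≤ 1)
    (hc : ∀ k, ‖(c k : ℂ)‖ ≤ 1) :
    star (diag (fun k => ((√(c k) : ℝ) : ℂ)) fun k => norm_sqrt_le (h1 k)) *
        diag (fun k => ((√(c k) : ℝ) : ℂ)) (fun k => norm_sqrt_le (h1 k)) =
      diag (fun k => (c k : ℂ)) hc := by
  rw [star_diag]
  ext1 x
  refine lp.ext (funext fun k => ?_)
  rw [mul_apply_eq_comp, diag_apply, diag_apply, diag_apply, ← mul_assoc, ← Complex.ofReal_mul,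
    Real.mul_self_sqrt (h0 k)]

theorem one_sub_mem {q : ℝ} (hq : q ∈ Set.Ioo (0 : ℝ) 1) (k : ℕ) :
    0 ≤ 1 - (q ^ k) ^ 2 ∧ 1 - (q ^ k) ^ 2 ≤ 1 := by
  have h0 : 0 ≤ q ^ k := pow_nonneg hq.1.le k
  have h1 : q ^ k ≤ 1 := pow_le_one₀ hq.1.le hq.2.le
  constructor <;> nlinarith

theorem sqrt_one_sub_sq {q : ℝ} (hq : q ∈ Set.Ioo (0 : ℝ) 1) :
    opSqrt (1 - Q hq ^ 2) = diag (fun k => ((√(1 - (q ^ k) ^ 2) : ℝ) : ℂ))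
      (fun k => norm_sqrt_le (one_sub_mem hq k).2) := by
  refine opSqrt_eq ?_ (diag_star_mul_sqrt _ (fun k => Real.sqrt_nonneg _)
    (fun k => Real.sqrt_le_one.2 (one_sub_mem hq k).2) _)
  · ext1 x
    refine lp.ext (funext fun k => ?_)
    rw [mul_apply_eq_comp, diag_apply, diag_apply, ← mul_assoc, ← Complex.ofReal_mul,
      Real.mul_self_sqrt (one_sub_mem hq k).1]
    change _ = x k - ((q ^ k : ℝ) : ℂ) * (((q ^ k : ℝ) : ℂ) * x k)
    push_cast
    ring

/-- The operators `S √(1 - Q²) ⊗ 1` and `Q ⊗ U`, with `U` the multiplication by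
`x ↦ exp (2 π i t x)`, satisfy the defining relations. -/
theorem relations_tens {q : ℝ} (hq : q ∈ Set.Ioo (0 : ℝ) 1) (t : ℝ) :
    Relations q (tens (S * opSqrt (1 - Q hq ^ 2)) 1) (tens (Q hq) (phaseMul t)) := by
  have hQ : star (Q hq) = Q hq := star_diag _ _
  have hD : star (opSqrt (1 - Q hq ^ 2)) = opSqrt (1 - Q hq ^ 2) := by
    rw [sqrt_one_sub_sq, star_diag]
  have key1 : star (S * opSqrt (1 - Q hq ^ 2)) * (S * opSqrt (1 - Q hq ^ 2)) + Q hq * Q hq = 1 := by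
    rw [star_mul, hD, sqrt_one_sub_sq]
    ext1 x
    refine lp.ext (funext fun k => ?_)
    simp only [add_apply, mul_apply_eq_comp, one_apply_eq_self, lp.coeFn_add, Pi.add_apply,
      diag_apply, Q]
    cases k with
    | zero => simp
    | succ k =>
      rw [star_S_succ, S_apply, diag_apply, ← mul_assoc, ← Complex.ofReal_mul,
        Real.mul_self_sqrt (one_sub_mem hq _).1]
      push_cast
      ring
  have key2 : (S * opSqrt (1 - Q hq ^ 2)) * star (S * opSqrt (1 - Q hq ^ 2)) +
      ((q : ℂ) ^ 2) • (Q hq * Q hq) = 1 := by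
    rw [star_mul, hD, sqrt_one_sub_sq]
    ext1 x
    refine lp.ext (funext fun k => ?_)
    simp only [add_apply, mul_apply_eq_comp, one_apply_eq_self, lp.coeFn_add, Pi.add_apply,
      smul_apply, lp.coeFn_smul, Pi.smul_apply, smul_eq_mul, diag_apply, Q, S_apply, star_S_succ]
    rw [← mul_assoc, ← Complex.ofReal_mul, Real.mul_self_sqrt (one_sub_mem hq _).1]
    push_cast
    ring
  have key3 : (S * opSqrt (1 - Q hq ^ 2)) * Q hq =
      (q : ℂ) • (Q hq * (S * opSqrt (1 - Q hq ^ 2))) := by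
    rw [sqrt_one_sub_sq]
    ext1 x
    refine lp.ext (funext fun k => ?_)
    simp only [mul_apply_eq_comp, smul_apply, lp.coeFn_smul, Pi.smul_apply, smul_eq_mul,
      diag_apply, Q, S_apply]
    push_cast
    ring
  constructor
  · rw [star_tens, star_tens, tens_mul, tens_mul, star_phaseMul_mul, star_one, mul_one, hQ,
      ← tens_add_left, key1, tens_one]
  · rw [star_tens, star_tens, tens_mul, tens_mul, phaseMul_mul_star, star_one, mul_one, hQ,
      ← tens_smul_left, ← tens_add_left, key2, tens_one]
  · rw [tens_mul, tens_mul, key3, tens_smul_left, mul_one, one_mul, sub_self]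
  · rw [star_tens, tens_mul, tens_mul, hQ, key3, tens_smul_left, mul_one, one_mul, sub_self]
  · rw [star_tens, tens_mul, tens_mul, star_phaseMul_mul, phaseMul_mul_star, hQ]

/-- The representation of `C(SU_q(2))` on `ℓ²(ℕ) ⊗ L²(ℝ)` with `α ↦ S √(1 - Q²) ⊗ 1` and
`β ↦ Q ⊗ R_ℝ`. -/
def rep {q : ℝ} (hq : q ∈ Set.Ioo (0 : ℝ) 1) : CSUq q →⋆ₐ[ℂ] (Hilb →L[ℂ] Hilb) :=
  lift (relations_tens hq 1)

theorem rep_alpha {q : ℝ} (hq : q ∈ Set.Ioo (0 : ℝ) 1) :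
    rep hq (alpha q) = tens (S * opSqrt (1 - Q hq ^ 2)) 1 :=
  lift_alpha _

theorem rep_beta {q : ℝ} (hq : q ∈ Set.Ioo (0 : ℝ) 1) :
    rep hq (beta q) = tens (Q hq) (phaseMul 1) :=
  lift_beta _

/-- Continuous functions `f_k` with `f_k (q^{2k}) = 1` and `f_k (t) = 0` for `t ≤ q^{2k+1}` and for
`t ≥ q^{2k-1}`. -/
structure IsBumpFamily (q : ℝ) (f : ℕ → ℝ → ℝ) : Prop where
  continuous : ∀ k, Continuous (f k)
  zero_of_le : ∀ (k : ℕ) (t : ℝ), t ≤ q ^ (2 * (k : ℤ) + 1) → f k t = 0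
  zero_of_ge : ∀ (k : ℕ) (t : ℝ), q ^ (2 * (k : ℤ) - 1) ≤ t → f k t = 0
  one_at : ∀ k : ℕ, f k (q ^ (2 * (k : ℤ))) = 1

/-- The spectral projection `p_k = f_k (β β*)` in `C(SU_q(2))`, by continuous functional calculus. -/
def specProj (q : ℝ) (f : ℕ → ℝ → ℝ) (k : ℕ) : CSUq q :=
  cfc (f k) (beta q * star (beta q))

/-- The operator `p_k ⊗ R_ℝ^{1/n}`: the representation maps `p_k` to an operator of the form
`P ⊗ 1`, and this is its product with `1 ⊗ R_ℝ^{1/n}`. -/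
def projTensRoot {q : ℝ} (hq : q ∈ Set.Ioo (0 : ℝ) 1) (n : ℕ) (f : ℕ → ℝ → ℝ) (k : ℕ) :
    Hilb →L[ℂ] Hilb :=
  rep hq (specProj q f k) * tens 1 (phaseMul (1 / n))

/-- The `k`-th term `(q^{1/n})^k p_k ⊗ R_ℝ^{1/n}` of the series for `betaTilde`. -/
def betaTildeTerm {q : ℝ} (hq : q ∈ Set.Ioo (0 : ℝ) 1) (n : ℕ) (f : ℕ → ℝ → ℝ) (k : ℕ) :
    Hilb →L[ℂ] Hilb :=
  (((q ^ (1 / n : ℝ)) ^ k : ℝ) : ℂ) • projTensRoot hq n f k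

/-- The sum of `(q^{1/n})^k p_k ⊗ R_ℝ^{1/n}` over all `k`, in the operator norm. -/
def betaTilde {q : ℝ} (hq : q ∈ Set.Ioo (0 : ℝ) 1) (n : ℕ) (f : ℕ → ℝ → ℝ) : Hilb →L[ℂ] Hilb :=
  ∑' k, betaTildeTerm hq n f k

/-- The covering algebra: the C*-algebra of operators generated by the represented algebra
`C(SU_q(2))` and `betaTilde`. -/
def coveringAlgebra {q : ℝ} (hq : q ∈ Set.Ioo (0 : ℝ) 1) (n : ℕ) (f : ℕ → ℝ → ℝ) :
    StarSubalgebra ℂ (Hilb →L[ℂ] Hilb) :=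
  (StarAlgebra.adjoin ℂ (Set.range (rep hq) ∪ {betaTilde hq n f})).topologicalClosure

/-- The `k`-th term `q^k p_k ⊗ R_ℝ^{1/n}` of the series for `betaTildeTilde`. -/
def betaTildeTildeTerm {q : ℝ} (hq : q ∈ Set.Ioo (0 : ℝ) 1) (n : ℕ) (f : ℕ → ℝ → ℝ) (k : ℕ) :
    Hilb →L[ℂ] Hilb :=
  ((q ^ k : ℝ) : ℂ) • projTensRoot hq n f k

/-- The sum of `q^k p_k ⊗ R_ℝ^{1/n}` over all `k`, in the operator norm. -/
def betaTildeTilde {q : ℝ} (hq : q ∈ Set.Ioo (0 : ℝ) 1) (n : ℕ) (f : ℕ → ℝ → ℝ) :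
    Hilb →L[ℂ] Hilb :=
  ∑' k, betaTildeTildeTerm hq n f k

end

end QuantumSU2

/-!
Write `R` for the multiplication by `exp (2 π i x)` on `L²(ℝ)` and `P_k` for the projection of
`ℓ²(ℕ) ⊗ L²(ℝ)` onto the `k`-th copy of `L²(ℝ)`. The operator `Q² ⊗ 1` representing `β β*` acts on
this copy as `q ^ (2 k)`, so the bump functions give `p_k ↦ P_k` (`phaseRep_specProj`), and the
two series sum in norm to `Q^{1/n} ⊗ R^{1/n}` and `Q ⊗ R^{1/n}` (`tsum_pow_smul_tens`). The
relations for the second operator are `relations_tens`, and hence there is a representation `ψ`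
with `α ↦ π(α)` and `β ↦ Q ⊗ R^{1/n}`; the projections `P_k` lie in its range. A closed *-algebra
that contains the `P_k` and one of the operators `Q^s ⊗ R^{1/n}`, `s > 0`, contains all their
slices `P_k (1 ⊗ R^{1/n})`, the `n`-th powers `P_k (1 ⊗ R)` of these, and therefore `Q^{1/n} ⊗
R^{1/n}`, `Q ⊗ R^{1/n}` and `Q ⊗ R` (`tens_Q_mem`). So the range of `ψ` is the covering algebra,
and what remains is that `ψ` is injective (`phaseRep_injective`).

Injectivity is a gauge-invariant uniqueness argument. The torus acts by `α ↦ z α`, `β ↦ w β`. The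
mean of this action maps a polynomial in the generators to a polynomial in `β β*`, the same one at
every pair that satisfies the relations (`exists_average_eq_aeval`). At every such pair the
spectrum of `b b*` is contained in `{0} ∪ {q ^ (2 k)}` (`Relations.spectrum_subset`), and all
these points are in the spectrum of `Q² ⊗ 1`; hence means have the largest norm in the
representation `ψ` (`norm_average_le_norm_average_phaseRep`). The gauge action on the range of `ψ`
is implemented by unitaries: diagonal ones on `ℓ²(ℕ)` and translations of `ℝ`
(`exists_gauge_phaseRep`). If `ψ x = 0`, then the mean of `x* x` vanishes under `ψ`, hence
everywhere, and since averaging is faithful on positive elements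
(`eq_zero_of_integral_star_mul_self_eq_zero`), `x = 0`.
-/

open MeasureTheory
open scoped TensorProduct CStarAlgebra Polynomial

namespace QuantumSU2

noncomputable section

/-! ### Positivity of averages and eigenvectors of the functional calculus -/

/-- A continuous positive function with zero integral vanishes. Positivity is used through the order
only: near `t₀` the function is at least `F t₀ - ε`, on a set of positive measure, so that
`F t₀ ≤ ε`. -/
theorem eq_zero_of_integral_eq_zero {X B : Type*} [TopologicalSpace X] [CompactSpace X]
    [MeasurableSpace X] [BorelSpace X] (μ : Measure X) [IsFiniteMeasure μ] [μ.IsOpenPosMeasure]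
    [CStarAlgebra B] [PartialOrder B] [StarOrderedRing B] (F : C(X, B)) (hF : ∀ t, 0 ≤ F t)
    (h : ∫ t, F t ∂μ = 0) : F = 0 := by
  have hint : Integrable F μ := F.continuous.integrable_of_hasCompactSupport (.of_compactSpace F)
  ext t₀
  refine norm_le_zero_iff.1 (le_of_forall_pos_le_add fun ε hε => ?_)
  rw [zero_add, CStarAlgebra.norm_le_iff_le_algebraMap (F t₀) hε.le (hF t₀)]
  let U : Set X := {t | ‖F t - F t₀‖ < ε}
  have hU : IsOpen U := isOpen_lt (by fun_prop) (by fun_prop)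
  have hμ : 0 < μ.real U :=
    ENNReal.toReal_pos (hU.measure_pos μ ⟨t₀, by simpa [U] using hε⟩).ne' (measure_ne_top _ _)
  have hle : ∀ t ∈ U, F t₀ - algebraMap ℝ B ε ≤ F t := by
    intro t ht
    have hsa : IsSelfAdjoint (F t₀ - F t) :=
      (IsSelfAdjoint.of_nonneg (hF t₀)).sub (.of_nonneg (hF t))
    have h2 : F t₀ - F t ≤ algebraMap ℝ B ε :=
      hsa.le_algebraMap_norm_self.trans (algebraMap_mono B (by rw [norm_sub_rev]; exact ht.le))
    exact sub_le_comm.1 h2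
  have h1 : ∫ t in U, (F t₀ - algebraMap ℝ B ε) ∂μ ≤ 0 := by
    rw [← h]
    refine (setIntegral_mono_on (by simp) hint.integrableOn hU.measurableSet hle).trans ?_
    exact setIntegral_le_integral hint (.of_forall hF)
  rw [setIntegral_const] at h1
  have h2 := smul_le_smul_of_nonneg_left h1 (inv_nonneg.2 hμ.le)
  rw [smul_zero, smul_smul, inv_mul_cancel₀ hμ.ne', one_smul] at h2
  exact sub_nonpos.1 h2

/-- Faithfulness of averaging: the mean of `G* G` determines whether `G` vanishes. -/
theorem eq_zero_of_integral_star_mul_self_eq_zero {X B : Type*} [TopologicalSpace X]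
    [CompactSpace X] [MeasurableSpace X] [BorelSpace X] (μ : Measure X) [IsFiniteMeasure μ]
    [μ.IsOpenPosMeasure] [CStarAlgebra B] (G : C(X, B)) (h : ∫ t, (star G * G) t ∂μ = 0) :
    G = 0 := by
  let _ := CStarAlgebra.spectralOrder B
  have := CStarAlgebra.spectralOrderedRing B
  exact CStarRing.star_mul_self_eq_zero_iff G |>.1 <|
    eq_zero_of_integral_eq_zero μ _ (fun t => star_mul_self_nonneg (G t)) h

/-- The continuous functional calculus of `h` acts on an eigenvector `e` (in the left regular
representation) with eigenvalue `c` as multiplication by `f c`. -/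
theorem cfc_mul_of_mul_eq_smul {A : Type*} [CStarAlgebra A] {h e : A} (hh : IsSelfAdjoint h)
    {c : ℝ} (he : h * e = c • e) {f : ℝ → ℝ} (hf : Continuous f) :
    cfc f h * e = f c • e := by
  rcases eq_or_ne e 0 with rfl | he0
  · simp
  have hc : c ∈ spectrum ℝ h := by
    rw [spectrum.mem_iff]
    rintro ⟨u, hu⟩
    refine he0 (u.isUnit.mul_right_eq_zero.1 ?_)
    rw [hu, sub_mul, he, Algebra.algebraMap_eq_smul_one, smul_mul_assoc, one_mul, sub_self]
  have key : ∀ g : C(spectrum ℝ h, ℝ), cfcHom hh g * e = g ⟨c, hc⟩ • e := by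
    intro g
    have hid : cfcHom hh (.restrict (spectrum ℝ h) (.id ℝ)) * e = c • e := by
      rw [cfcHom_id hh, he]
    induction g using ContinuousMap.induction_on_of_compact with
    | const r =>
      rw [show ContinuousMap.const (spectrum ℝ h) r = algebraMap ℝ _ r from rfl,
        AlgHomClass.commutes, Algebra.algebraMap_eq_smul_one, smul_mul_assoc, one_mul]
      rfl
    | id => exact hid
    | star_id => exact hid
    | add g₁ g₂ h₁ h₂ => rw [map_add, add_mul, h₁, h₂, ContinuousMap.add_apply, add_smul]
    | mul g₁ g₂ h₁ h₂ =>
      rw [map_mul, mul_assoc, h₂, mul_smul_comm, h₁, smul_smul, ContinuousMap.mul_apply, mul_comm]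
    | frequently g hg =>
      have hcl : IsClosed {g : C(spectrum ℝ h, ℝ) | cfcHom hh g * e = g ⟨c, hc⟩ • e} := by
        have : Continuous (cfcHom (R := ℝ) hh) := cfcHom_continuous hh
        refine isClosed_eq (by fun_prop) ?_
        have hev : Continuous fun g : C(spectrum ℝ h, ℝ) => g ⟨c, hc⟩ := by fun_prop
        exact hev.smul continuous_const
      exact isClosed_iff_frequently.1 hcl g hg
  rw [cfc_apply f h, key]
  rfl

/-! ### The spectrum of `b b*` -/

/-- Since `a* a = 1 - b b*` and `a a* = 1 - q² b b*`, and `a* a` and `a a*` have the same nonzero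
spectrum, points of the spectrum of `b b*` other than `1` stay in it after division by `q²`. -/
theorem Relations.div_mem_spectrum {A : Type*} [CStarAlgebra A] {q : ℝ} (hq : q ∈ Set.Ioo (0 : ℝ) 1)
    {a b : A} (h : Relations q a b) {z : ℂ} (hz : z ∈ spectrum ℂ (b * star b)) (h1 : z ≠ 1) :
    z / (q : ℂ) ^ 2 ∈ spectrum ℂ (b * star b) := by
  have hq0 : (q : ℂ) ^ 2 ≠ 0 := pow_ne_zero 2 (Complex.ofReal_ne_zero.2 hq.1.ne')
  have ha : star a * a = algebraMap ℂ A 1 - b * star b := by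
    rw [map_one, ← h.normal, ← h.star_mul_add, add_sub_cancel_right]
  have ha' : a * star a = algebraMap ℂ A 1 - Units.mk0 _ hq0 • (b * star b) := by
    rw [map_one, ← h.mul_star_add, Units.smul_mk0, add_sub_cancel_right]
  have hmem : 1 - z ∈ spectrum ℂ (star a * a) \ {0} := by
    refine ⟨?_, fun h0 => h1 (sub_eq_zero.1 h0).symm⟩
    rw [ha, ← spectrum.singleton_sub_eq]
    exact Set.sub_mem_sub rfl hz
  rw [spectrum.nonzero_mul_comm, ha', ← spectrum.singleton_sub_eq,
    spectrum.unit_smul_eq_smul] at hmem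
  obtain ⟨_, rfl, _, ⟨w, hw, rfl⟩, hwz⟩ := hmem.1
  have : z = (q : ℂ) ^ 2 * w := (sub_right_injective hwz).symm
  rwa [this, mul_div_cancel_left₀ _ hq0]

/-- The spectrum of `b b*` consists of powers of `q²`, and possibly of their limit `0`: from any
other point, repeated division by `q²` would lead out of every bounded set without leaving the
spectrum. -/
theorem Relations.spectrum_subset {A : Type*} [CStarAlgebra A] {q : ℝ}
    (hq : q ∈ Set.Ioo (0 : ℝ) 1) {a b : A} (h : Relations q a b) :
    spectrum ℂ (b * star b) ⊆ closure (Set.range fun k : ℕ => ((q : ℂ) ^ 2) ^ k) := by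
  intro z hz
  by_contra hcl
  have hne : ∀ k : ℕ, z ≠ ((q : ℂ) ^ 2) ^ k := by
    rintro k rfl
    exact hcl (subset_closure ⟨k, rfl⟩)
  have hq0 : (q : ℂ) ^ 2 ≠ 0 := pow_ne_zero 2 (Complex.ofReal_ne_zero.2 hq.1.ne')
  have hlt : ‖(q : ℂ) ^ 2‖ < 1 := by
    rw [norm_pow, Complex.norm_real, Real.norm_of_nonneg hq.1.le]
    exact pow_lt_one₀ hq.1.le hq.2 two_ne_zero
  have hmem : ∀ k : ℕ, z / ((q : ℂ) ^ 2) ^ k ∈ spectrum ℂ (b * star b) := by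
    intro k
    induction k with
    | zero => simpa using hz
    | succ k ih =>
      rw [pow_succ, ← div_div]
      refine h.div_mem_spectrum hq ih fun h1 => hne k ?_
      rwa [div_eq_one_iff_eq (pow_ne_zero k hq0)] at h1
  have hbound : ∀ k : ℕ, ‖z‖ ≤ ‖(q : ℂ) ^ 2‖ ^ k * (‖b * star b‖ * ‖(1 : A)‖) := by
    intro k
    have := spectrum.norm_le_norm_mul_of_mem (hmem k)
    rwa [norm_div, norm_pow, div_le_iff₀' (pow_pos (norm_pos_iff.2 hq0) k)] at this
  have hz0 : z = 0 := by
    have hlim := (tendsto_pow_atTop_nhds_zero_of_lt_one (norm_nonneg _) hlt).mul_const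
      (‖b * star b‖ * ‖(1 : A)‖)
    rw [zero_mul] at hlim
    exact norm_le_zero_iff.1 (ge_of_tendsto' hlim hbound)
  refine hcl (hz0 ▸ mem_closure_of_tendsto (tendsto_pow_atTop_nhds_zero_of_norm_lt_one hlt)
    (.of_forall fun k => ⟨k, rfl⟩))

/-! ### Normally ordered monomials -/

/-- The normally ordered monomials `b ^ l * b* ^ m * a ^ k` and `b ^ l * b* ^ m * a* ^ k`. -/
def monomials {A : Type*} [CStarAlgebra A] (a b : A) : Set A :=
  {x | ∃ l m k : ℕ, x = b ^ l * star b ^ m * a ^ k ∨ x = b ^ l * star b ^ m * star a ^ k}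

theorem mul_pow_of_mul_eq_smul {A : Type*} [Ring A] [Algebra ℂ A] {x y : A} {c : ℂ}
    (h : x * y = c • (y * x)) (l : ℕ) : x * y ^ l = c ^ l • (y ^ l * x) := by
  induction l with
  | zero => simp
  | succ l ih =>
    rw [pow_succ, ← mul_assoc, ih, smul_mul_assoc, mul_assoc, h, mul_smul_comm, smul_smul,
      mul_assoc, pow_succ]

/-- Moving `x` to the right past a word in two elements with which it commutes up to a factor. -/
theorem mul_pow_mul_pow_of_mul_eq_smul {A : Type*} [Ring A] [Algebra ℂ A] {x y z : A} {c : ℂ}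
    (hy : x * y = c • (y * x)) (hz : x * z = c • (z * x)) (l m : ℕ) (w : A) :
    x * (y ^ l * z ^ m * w) = c ^ (l + m) • (y ^ l * z ^ m * (x * w)) := by
  rw [← mul_assoc, ← mul_assoc, mul_pow_of_mul_eq_smul hy, smul_mul_assoc, mul_assoc (y ^ l),
    mul_pow_of_mul_eq_smul hz, mul_smul_comm, smul_smul, smul_mul_assoc, pow_add]
  simp only [mul_assoc]

section

variable {A : Type*} [CStarAlgebra A] {q : ℝ} {a b : A}

theorem monomial_mem_span (l m k : ℕ) :
    b ^ l * star b ^ m * a ^ k ∈ Submodule.span ℂ (monomials a b) :=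
  Submodule.subset_span ⟨l, m, k, .inl rfl⟩

theorem monomial_star_mem_span (l m k : ℕ) :
    b ^ l * star b ^ m * star a ^ k ∈ Submodule.span ℂ (monomials a b) :=
  Submodule.subset_span ⟨l, m, k, .inr rfl⟩

theorem Relations.star_left_mul (hq : q ∈ Set.Ioo (0 : ℝ) 1) (h : Relations q a b) :
    star a * b = (q : ℂ)⁻¹ • (b * star a) := by
  have h1 := congrArg star (sub_eq_zero.1 h.comm_star)
  rw [star_mul, star_star, star_smul, star_mul, star_star] at h1
  rw [h1, Complex.star_def, Complex.conj_ofReal,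
    inv_smul_smul₀ (Complex.ofReal_ne_zero.2 hq.1.ne')]

theorem Relations.star_left_mul_star (hq : q ∈ Set.Ioo (0 : ℝ) 1) (h : Relations q a b) :
    star a * star b = (q : ℂ)⁻¹ • (star b * star a) := by
  have h1 := congrArg star (sub_eq_zero.1 h.comm)
  rw [star_mul, star_smul, star_mul] at h1
  rw [h1, Complex.star_def, Complex.conj_ofReal,
    inv_smul_smul₀ (Complex.ofReal_ne_zero.2 hq.1.ne')]

/-- The span of the normally ordered monomials is stable under left multiplication by the
generators and their adjoints: `a` and `a*` move past `b` and `b*` up to a factor, and `a a*` and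
`a* a` are polynomials in `b b*`. -/
theorem Relations.mul_mem_span (hq : q ∈ Set.Ioo (0 : ℝ) 1) (h : Relations q a b) {g x : A}
    (hg : g ∈ ({a, b} ∪ star {a, b} : Set A)) (hx : x ∈ Submodule.span ℂ (monomials a b)) :
    g * x ∈ Submodule.span ℂ (monomials a b) := by
  have hb : Commute (star b) b := h.normal
  have hb1 (l m : ℕ) (w : A) : b * (b ^ l * star b ^ m * w) = b ^ (l + 1) * star b ^ m * w := by
    rw [pow_succ']; simp only [mul_assoc]
  have hb2 (l m : ℕ) (w : A) :
      star b * (b ^ l * star b ^ m * w) = b ^ l * star b ^ (m + 1) * w := by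
    rw [pow_succ', ← mul_assoc, ← mul_assoc, (hb.pow_right l).eq]; simp only [mul_assoc]
  have hbb (l m : ℕ) (w : A) :
      b ^ l * star b ^ m * (b * star b * w) = b ^ (l + 1) * star b ^ (m + 1) * w := by
    rw [pow_succ, pow_succ, mul_assoc b, mul_assoc (b ^ l), ← mul_assoc _ b, (hb.pow_left m).eq]
    simp only [mul_assoc]
  have ha2 : a * star a = 1 - ((q : ℂ) ^ 2) • (b * star b) := by
    rw [← h.mul_star_add, add_sub_cancel_right]
  have ha1 : star a * a = 1 - b * star b := by
    rw [← h.normal, ← h.star_mul_add, add_sub_cancel_right]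
  induction hx using Submodule.span_induction with
  | zero => simp
  | add x y _ _ hx hy => rw [mul_add]; exact add_mem hx hy
  | smul c x _ hx => rw [mul_smul_comm]; exact Submodule.smul_mem _ c hx
  | mem x hx =>
    obtain ⟨l, m, k, hx⟩ := hx
    have hg' : g = a ∨ g = b ∨ g = star a ∨ g = star b := by
      have hs : ∀ c : A, star g = c ↔ g = star c := fun c => star_eq_iff_star_eq.trans eq_comm
      simpa [or_assoc, hs] using hg
    rcases hg' with hg' | hg' | hg' | hg' <;> rw [hg']
    · rcases hx with rfl | rfl <;>
        rw [mul_pow_mul_pow_of_mul_eq_smul (sub_eq_zero.1 h.comm) (sub_eq_zero.1 h.comm_star)] <;>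
        refine Submodule.smul_mem _ _ ?_
      · rw [← pow_succ']
        exact monomial_mem_span _ _ _
      · cases k with
        | zero =>
          rw [pow_zero, mul_one]
          simpa using monomial_mem_span (a := a) (b := b) l m 1
        | succ k =>
          rw [pow_succ', ← mul_assoc a, ha2, sub_mul, one_mul, mul_sub]
          refine sub_mem ?_ ?_
          · exact monomial_star_mem_span _ _ _
          · rw [smul_mul_assoc, mul_smul_comm, hbb]
            exact Submodule.smul_mem _ _ (monomial_star_mem_span _ _ _)
    · rcases hx with rfl | rfl <;> rw [hb1]
      · exact monomial_mem_span _ _ _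
      · exact monomial_star_mem_span _ _ _
    · rcases hx with rfl | rfl <;>
        rw [mul_pow_mul_pow_of_mul_eq_smul (h.star_left_mul hq) (h.star_left_mul_star hq)] <;>
        refine Submodule.smul_mem _ _ ?_
      · cases k with
        | zero =>
          rw [pow_zero, mul_one]
          simpa using monomial_star_mem_span (a := a) (b := b) l m 1
        | succ k =>
          rw [pow_succ', ← mul_assoc (star a), ha1, sub_mul, one_mul, mul_sub]
          refine sub_mem ?_ ?_
          · exact monomial_mem_span _ _ _
          · rw [hbb]
            exact monomial_mem_span _ _ _
      · rw [← pow_succ']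
        exact monomial_star_mem_span _ _ _
    · rcases hx with rfl | rfl <;> rw [hb2]
      · exact monomial_mem_span _ _ _
      · exact monomial_star_mem_span _ _ _

theorem Relations.adjoin_le_span (hq : q ∈ Set.Ioo (0 : ℝ) 1) (h : Relations q a b) :
    (StarAlgebra.adjoin ℂ {a, b}).toSubalgebra.toSubmodule ≤ Submodule.span ℂ (monomials a b) := by
  rw [StarAlgebra.adjoin_eq_span, Submodule.span_le]
  intro x hx
  induction hx using Submonoid.closure_induction_left with
  | one => simpa using monomial_mem_span (a := a) (b := b) 0 0 0
  | mul_left g hg x _ ih => exact h.mul_mem_span hq hg ih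

end

/-! ### Integrals of characters of the torus -/

/-- The torus `𝕋 × 𝕋`, written additively. -/
abbrev Torus : Type := UnitAddCircle × UnitAddCircle

/-- The normalized Haar measure of the torus. -/
abbrev torusMeasure : Measure Torus :=
  (AddCircle.haarAddCircle (T := 1)).prod (AddCircle.haarAddCircle (T := 1))

theorem integral_fourier (n : ℤ) :
    ∫ t : UnitAddCircle, fourier n t ∂AddCircle.haarAddCircle = if n = 0 then 1 else 0 := by
  have := congrFun (fourierCoeff_fourier (T := 1) n) 0
  simpa [fourierCoeff, Pi.single_apply, eq_comm] using this

theorem integral_fourier_mul_fourier (m n : ℤ) :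
    ∫ t : Torus, fourier m t.1 * fourier n t.2 ∂torusMeasure =
      if m = 0 ∧ n = 0 then (1 : ℂ) else 0 := by
  rw [integral_prod_mul (fun s : UnitAddCircle => (fourier m s : ℂ)) (fun s => fourier n s),
    integral_fourier, integral_fourier]
  split_ifs <;> simp_all

/-! ### The gauge action and its mean -/

/-- The function `(z, w) ↦ z ^ m * w ^ n • x` on the torus, where `z` and `w` are the values of the
first Fourier character at the two coordinates. -/
def homogeneous {B : Type*} [CStarAlgebra B] (m n : ℤ) (x : B) : C(Torus, B) where
  toFun t := (fourier m t.1 * fourier n t.2 : ℂ) • x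
  continuous_toFun := by fun_prop

theorem homogeneous_apply {B : Type*} [CStarAlgebra B] (m n : ℤ) (x : B) (t : Torus) :
    homogeneous m n x t = (fourier m t.1 * fourier n t.2 : ℂ) • x := rfl

section
variable {B : Type*} [CStarAlgebra B]

theorem homogeneous_mul (m n m' n' : ℤ) (x y : B) :
    homogeneous m n x * homogeneous m' n' y = homogeneous (m + m') (n + n') (x * y) := by
  ext t
  simp only [ContinuousMap.mul_apply, homogeneous_apply, fourier_add, smul_mul_smul_comm]
  ring_nf

theorem homogeneous_one : homogeneous 0 0 (1 : B) = 1 := by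
  ext t
  simp [homogeneous_apply]

theorem homogeneous_pow (m n : ℤ) (x : B) (k : ℕ) :
    homogeneous m n x ^ k = homogeneous (k * m) (k * n) (x ^ k) := by
  induction k with
  | zero => simp [homogeneous_one]
  | succ k ih => rw [pow_succ, ih, homogeneous_mul, pow_succ]; push_cast; ring_nf

theorem star_homogeneous (m n : ℤ) (x : B) :
    star (homogeneous m n x) = homogeneous (-m) (-n) (star x) := by
  ext t
  simp [homogeneous_apply]

theorem smul_homogeneous (c : ℂ) (m n : ℤ) (x : B) :
    c • homogeneous m n x = homogeneous m n (c • x) := by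
  ext t
  simp [homogeneous_apply, smul_comm c]

theorem homogeneous_add (m n : ℤ) (x y : B) :
    homogeneous m n (x + y) = homogeneous m n x + homogeneous m n y := by
  ext t
  simp [homogeneous_apply]

theorem integral_homogeneous (m n : ℤ) (x : B) :
    ∫ t, homogeneous m n x t ∂torusMeasure = if m = 0 ∧ n = 0 then x else 0 := by
  simp only [homogeneous_apply]
  rw [integral_smul_const, integral_fourier_mul_fourier]
  split_ifs <;> simp

/-- Multiplying `a` and `b` by independent phases preserves the relations. -/
theorem Relations.homogeneous {q : ℝ} {a b : B} (h : Relations q a b) :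
    Relations q (homogeneous 1 0 a) (homogeneous 0 1 b) where
  star_mul_add := by
    simp only [star_homogeneous, homogeneous_mul]
    simp [← homogeneous_add, h.star_mul_add, homogeneous_one]
  mul_star_add := by
    simp only [star_homogeneous, homogeneous_mul, smul_homogeneous]
    simp [← homogeneous_add, h.mul_star_add, homogeneous_one]
  comm := by
    simp only [homogeneous_mul, smul_homogeneous, sub_eq_zero.1 h.comm]
    simp
  comm_star := by
    simp only [star_homogeneous, homogeneous_mul, smul_homogeneous, sub_eq_zero.1 h.comm_star]
    simp
  normal := by
    simp only [star_homogeneous, homogeneous_mul, h.normal]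
    simp
end

/-- Evaluation of continuous functions at a point, as a *-homomorphism. -/
def evalTorus (B : Type*) [CStarAlgebra B] (t : Torus) : C(Torus, B) →⋆ₐ[ℂ] B where
  toFun f := f t
  map_one' := rfl
  map_mul' _ _ := rfl
  map_zero' := rfl
  map_add' _ _ := rfl
  commutes' _ := rfl
  map_star' _ := rfl

theorem evalTorus_apply (B : Type*) [CStarAlgebra B] (t : Torus) (f : C(Torus, B)) :
    evalTorus B t f = f t := rfl

section
variable {B : Type} [CStarAlgebra B] {q : ℝ} {a b : B}

/-- The gauge action of the torus, at a pair `(a, b)` that satisfies the relations: the image of `x`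
is the function on the torus whose value at `(z, w)` is the image of `x` under `α ↦ z a`,
`β ↦ w b`. -/
def gauge (h : Relations q a b) : CSUq q →⋆ₐ[ℂ] C(Torus, B) :=
  lift h.homogeneous

/-- The mean over the torus of the gauge action. On polynomials in the generators it keeps exactly
the terms of degree zero, which are polynomials in `b b*`. -/
def average (h : Relations q a b) (x : CSUq q) : B :=
  ∫ t, gauge h x t ∂torusMeasure

theorem gauge_apply (h : Relations q a b) (t : Torus) {φ : CSUq q →⋆ₐ[ℂ] B}
    (ha : φ (alpha q) = (fourier 1 t.1 : ℂ) • a) (hb : φ (beta q) = (fourier 1 t.2 : ℂ) • b)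
    (x : CSUq q) : gauge h x t = φ x := by
  have : (evalTorus B t).comp (gauge h) = φ := by
    refine hom_ext ?_ ?_
    · rw [ha, StarAlgHom.comp_apply, gauge, lift_alpha]
      simp [evalTorus_apply, homogeneous_apply]
    · rw [hb, StarAlgHom.comp_apply, gauge, lift_beta]
      simp [evalTorus_apply, homogeneous_apply]
  exact congrArg (fun g => g x) this

theorem norm_average_le (h : Relations q a b) (x : CSUq q) : ‖average h x‖ ≤ ‖x‖ := by
  refine (norm_integral_le_of_norm_le_const (.of_forall fun t =>
    (ContinuousMap.norm_coe_le_norm _ t).trans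
      (NonUnitalStarAlgHom.norm_apply_le (gauge h) x))).trans ?_
  simp

theorem average_add (h : Relations q a b) (x y : CSUq q) :
    average h (x + y) = average h x + average h y := by
  simp only [average, map_add, ContinuousMap.add_apply]
  exact integral_add ((gauge h x).continuous.integrable_of_hasCompactSupport (.of_compactSpace _))
    ((gauge h y).continuous.integrable_of_hasCompactSupport (.of_compactSpace _))

theorem average_smul (h : Relations q a b) (c : ℂ) (x : CSUq q) :
    average h (c • x) = c • average h x := by
  simp only [average, map_smul, ContinuousMap.smul_apply]
  exact integral_smul c _

theorem continuous_average (h : Relations q a b) : Continuous (average h) := by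
  let L : CSUq q →ₗ[ℂ] B :=
    { toFun := average h, map_add' := average_add h, map_smul' := average_smul h }
  exact (L.mkContinuous 1 fun x => (norm_average_le h x).trans_eq (one_mul _).symm).continuous

theorem average_monomial (h : Relations q a b) (l m k : ℕ) :
    average h (beta q ^ l * star (beta q) ^ m * alpha q ^ k) =
      if k = 0 ∧ l = m then (b * star b) ^ l else 0 := by
  have hc : Commute b (star b) := h.normal.symm
  simp only [average, gauge, map_mul, map_pow, map_star, lift_alpha, lift_beta, star_homogeneous,
    homogeneous_pow, homogeneous_mul, integral_homogeneous]
  refine (if_congr (show _ ↔ k = 0 ∧ l = m by omega) rfl rfl).trans ?_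
  split_ifs with hk
  · obtain ⟨rfl, rfl⟩ := hk
    rw [pow_zero, mul_one, hc.mul_pow]
  · rfl

theorem average_monomial_star (h : Relations q a b) (l m k : ℕ) :
    average h (beta q ^ l * star (beta q) ^ m * star (alpha q) ^ k) =
      if k = 0 ∧ l = m then (b * star b) ^ l else 0 := by
  have hc : Commute b (star b) := h.normal.symm
  simp only [average, gauge, map_mul, map_pow, map_star, lift_alpha, lift_beta, star_homogeneous,
    homogeneous_pow, homogeneous_mul, integral_homogeneous]
  refine (if_congr (show _ ↔ k = 0 ∧ l = m by omega) rfl rfl).trans ?_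
  split_ifs with hk
  · obtain ⟨rfl, rfl⟩ := hk
    rw [pow_zero, mul_one, hc.mul_pow]
  · rfl

end

/-- On polynomials in the generators the mean is a polynomial in `b b*`, which does not depend on
the pair `(a, b)`. -/
theorem exists_average_eq_aeval {q : ℝ} {x : CSUq q}
    (hx : x ∈ Submodule.span ℂ (monomials (alpha q) (beta q))) :
    ∃ P : ℂ[X], ∀ (B : Type) [CStarAlgebra B] (a b : B) (h : Relations q a b),
      average h x = Polynomial.aeval (b * star b) P := by
  induction hx using Submodule.span_induction with
  | zero => exact ⟨0, fun B _ a b h => by simp [average]⟩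
  | add x y _ _ hx hy =>
    obtain ⟨P, hP⟩ := hx
    obtain ⟨R, hR⟩ := hy
    exact ⟨P + R, fun B _ a b h => by rw [average_add, hP, hR, map_add]⟩
  | smul c x _ hx =>
    obtain ⟨P, hP⟩ := hx
    exact ⟨c • P, fun B _ a b h => by rw [average_smul, hP, map_smul]⟩
  | mem x hx =>
    obtain ⟨l, m, k, hx⟩ := hx
    refine ⟨if k = 0 ∧ l = m then .X ^ l else 0, fun B _ a b h => ?_⟩
    rcases hx with rfl | rfl <;> simp only [average_monomial, average_monomial_star] <;>
      split_ifs <;> simp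

/-- The inclusion into the product of all realizations is a closed embedding, so closures may be
taken there. -/
theorem adjoin_alpha_beta_dense (q : ℝ) :
    Dense (StarAlgebra.adjoin ℂ {alpha q, beta q} : Set (CSUq q)) := by
  have hcl : Topology.IsClosedEmbedding ((↑) : CSUq q → RealizationProduct q) :=
    IsClosed.isClosedEmbedding_subtypeVal (StarSubalgebra.isClosed_topologicalClosure _)
  rw [← StarSubalgebra.coe_subtype] at hcl
  have h := StarSubalgebra.topologicalClosure_map (StarAlgebra.adjoin ℂ {alpha q, beta q})
    (algebra q).subtype hcl.isClosedMap hcl.continuous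
  rw [StarAlgHom.map_adjoin, Set.image_pair] at h
  intro x
  obtain ⟨y, hy, hyx⟩ := h.le x.2
  rwa [← Subtype.ext hyx]

/-! ### Operators on the tensor product -/

theorem norm_single_le (k j : ℕ) : ‖((Pi.single k 1 : ℕ → ℝ) j : ℂ)‖ ≤ 1 := by
  rw [Pi.single_apply]
  split_ifs <;> simp

/-- The orthogonal projection of `ℓ²(ℕ)` onto the line spanned by `e_k`. -/
def coordProj (k : ℕ) : EllTwo →L[ℂ] EllTwo :=
  diag (fun j => ((Pi.single k 1 : ℕ → ℝ) j : ℂ)) (norm_single_le k)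

theorem coordProj_apply (k : ℕ) (x : EllTwo) : coordProj k x = lp.single 2 k (x k) := by
  refine lp.ext (funext fun j => ?_)
  rw [coordProj, diag_apply, lp.single_apply]
  rcases eq_or_ne j k with rfl | h
  · simp
  · simp [h]

theorem coordProj_mul_self (k : ℕ) : coordProj k * coordProj k = coordProj k := by
  ext1 x
  rw [mul_apply_eq_comp, coordProj_apply, coordProj_apply]
  simp

theorem coordProj_mul_of_ne {j k : ℕ} (h : j ≠ k) : coordProj j * coordProj k = 0 := by
  ext1 x
  rw [mul_apply_eq_comp, coordProj_apply, coordProj_apply]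
  simp [lp.single_apply, h]

theorem star_coordProj (k : ℕ) : star (coordProj k) = coordProj k := star_diag _ _

theorem Q_mul_coordProj {q : ℝ} (hq : q ∈ Set.Ioo (0 : ℝ) 1) (k : ℕ) :
    Q hq * coordProj k = ((q : ℂ) ^ k) • coordProj k := by
  ext1 x
  refine lp.ext (funext fun j => ?_)
  rw [mul_apply_eq_comp, Q, diag_apply, smul_apply, lp.coeFn_smul, Pi.smul_apply, coordProj,
    diag_apply, smul_eq_mul]
  rcases eq_or_ne j k with rfl | h
  · simp
  · simp [h]

/-- The projection onto the `k`-th copy of `L²(ℝ)` in `ℓ²(ℕ) ⊗ L²(ℝ)`. -/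
def sliceProj (k : ℕ) : Hilb →L[ℂ] Hilb := tens (coordProj k) 1

theorem tens_zero_left (B : LTwo →L[ℂ] LTwo) : tens 0 B = 0 := by
  simpa using tens_smul_left 0 0 B

theorem sliceProj_mul_self (k : ℕ) : sliceProj k * sliceProj k = sliceProj k := by
  rw [sliceProj, tens_mul, coordProj_mul_self, mul_one]

theorem sliceProj_mul_of_ne {j k : ℕ} (h : j ≠ k) : sliceProj j * sliceProj k = 0 := by
  rw [sliceProj, sliceProj, tens_mul, coordProj_mul_of_ne h, tens_zero_left]

theorem star_sliceProj (k : ℕ) : star (sliceProj k) = sliceProj k := by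
  rw [sliceProj, star_tens, star_coordProj, star_one]

theorem norm_sliceProj_le (k : ℕ) : ‖sliceProj k‖ ≤ 1 := by
  have h := CStarRing.norm_star_mul_self (x := sliceProj k)
  rw [star_sliceProj, sliceProj_mul_self] at h
  nlinarith [norm_nonneg (sliceProj k)]

/-- An operator is determined by its restrictions to the copies of `L²(ℝ)`. -/
theorem ext_sliceProj {T T' : Hilb →L[ℂ] Hilb} (h : ∀ k, T * sliceProj k = T' * sliceProj k) :
    T = T' := by
  refine ext_of fun x => ?_
  induction x with
  | zero => simp
  | add x y hx hy => simp only [map_add, hx, hy]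
  | tmul x y =>
    -- the operators agree on `e_k ⊗ y` for every `k`, and `x` is the sum of its coordinates
    let τ : EllTwo →L[ℂ] Hilb := Hilb.of.toContinuousLinearMap ∘L
      ((TensorProduct.mk ℂ EllTwo LTwo).flip y).mkContinuous ‖y‖
        fun x => by simp [TensorProduct.norm_tmul, mul_comm]
    have hτ : ∀ x, τ x = Hilb.of (x ⊗ₜ y) := fun _ => rfl
    have hsum : HasSum (fun k => lp.single 2 k (x k)) x := lp.hasSum_single (by simp) x
    have hk : ∀ k, T (τ (lp.single 2 k (x k))) = T' (τ (lp.single 2 k (x k))) := by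
      intro k
      have := congrArg (fun A : Hilb →L[ℂ] Hilb => A (τ x)) (h k)
      simpa [sliceProj, hτ, tens_of, TensorProduct.mapL_tmul, coordProj_apply, mul_apply_eq_comp]
        using this
    have h1 := (T ∘L τ).hasSum hsum
    have h2 := (T' ∘L τ).hasSum hsum
    exact h1.unique ((funext hk : _ = _) ▸ h2)

theorem exists_LTwo_ne_zero : ∃ y : LTwo, y ≠ 0 := by
  refine ⟨indicatorConstLp 2 (measurableSet_Icc (a := (0 : ℝ)) (b := 1)) (by simp) (1 : ℂ),
    norm_ne_zero_iff.1 ?_⟩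
  rw [norm_indicatorConstLp (by simp) (by simp)]
  simp

theorem sliceProj_ne_zero (k : ℕ) : sliceProj k ≠ 0 := by
  obtain ⟨y, hy⟩ := exists_LTwo_ne_zero
  intro h
  have h1 := congrArg (fun T : Hilb →L[ℂ] Hilb => ‖T (Hilb.of (lp.single 2 k 1 ⊗ₜ y))‖) h
  simp only [sliceProj, tens_of, TensorProduct.mapL_tmul, coordProj_apply, LinearIsometry.norm_map,
    TensorProduct.norm_tmul, one_apply_eq_self, zero_apply, norm_zero] at h1
  simp [hy] at h1

/-! ### The representations with `β ↦ Q ⊗ U` -/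

/-- The representation of `C(SU_q(2))` on `ℓ²(ℕ) ⊗ L²(ℝ)` with `β ↦ Q ⊗ U`, `U` the multiplication
by `x ↦ exp (2 π i t x)`. -/
def phaseRep {q : ℝ} (hq : q ∈ Set.Ioo (0 : ℝ) 1) (t : ℝ) : CSUq q →⋆ₐ[ℂ] (Hilb →L[ℂ] Hilb) :=
  lift (relations_tens hq t)

theorem tens_Q_mul_star {q : ℝ} (hq : q ∈ Set.Ioo (0 : ℝ) 1) (t : ℝ) :
    tens (Q hq) (phaseMul t) * star (tens (Q hq) (phaseMul t)) = tens (Q hq * Q hq) 1 := by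
  rw [star_tens, tens_mul, phaseMul_mul_star, Q, star_diag]

theorem tens_Q_mul_sliceProj {q : ℝ} (hq : q ∈ Set.Ioo (0 : ℝ) 1) (k : ℕ) :
    tens (Q hq * Q hq) 1 * sliceProj k = ((q : ℂ) ^ 2) ^ k • sliceProj k := by
  rw [sliceProj, tens_mul, mul_assoc, Q_mul_coordProj, mul_smul_comm, Q_mul_coordProj, smul_smul,
    tens_smul_left, mul_one, ← pow_add, ← pow_mul, two_mul]

theorem IsBumpFamily.apply_pow {q : ℝ} (hq : q ∈ Set.Ioo (0 : ℝ) 1) {f : ℕ → ℝ → ℝ}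
    (hf : IsBumpFamily q f) (k j : ℕ) : f k ((q ^ 2) ^ j) = if j = k then 1 else 0 := by
  have hz : (q ^ 2) ^ j = q ^ (2 * (j : ℤ)) := by
    rw [← pow_mul, ← zpow_natCast]; push_cast; rfl
  rw [hz]
  split_ifs with h
  · rw [h, hf.one_at]
  · rcases lt_or_gt_of_ne h with h | h
    · exact hf.zero_of_ge k _ (zpow_le_zpow_right_of_le_one₀ hq.1 hq.2.le (by omega))
    · exact hf.zero_of_le k _ (zpow_le_zpow_right_of_le_one₀ hq.1 hq.2.le (by omega))

theorem map_cfc_real {A B : Type*} [CStarAlgebra A] [CStarAlgebra B] (φ : A →⋆ₐ[ℂ] B) {f : ℝ → ℝ}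
    (hf : Continuous f) {x : A} (hx : IsSelfAdjoint x) : φ (cfc f x) = cfc f (φ x) :=
  StarAlgHomClass.map_cfc (S := ℂ) φ f x hf.continuousOn (map_continuous φ) hx (hx.map φ)

/-- The spectral projection `p_k` acts as the projection onto the `k`-th copy of `L²(ℝ)`. -/
theorem phaseRep_specProj {q : ℝ} (hq : q ∈ Set.Ioo (0 : ℝ) 1) (t : ℝ) {f : ℕ → ℝ → ℝ}
    (hf : IsBumpFamily q f) (k : ℕ) : phaseRep hq t (specProj q f k) = sliceProj k := by
  have hsa : IsSelfAdjoint (beta q * star (beta q)) := .mul_star_self _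
  have hsa' : IsSelfAdjoint (tens (Q hq * Q hq) 1) := by
    rw [← tens_Q_mul_star hq t]; exact .mul_star_self _
  rw [specProj, map_cfc_real (phaseRep hq t) (hf.continuous k) hsa, map_mul, map_star, phaseRep,
    lift_beta, tens_Q_mul_star]
  refine ext_sliceProj fun j => ?_
  have he : tens (Q hq * Q hq) 1 * sliceProj j = (q ^ 2) ^ j • sliceProj j := by
    rw [tens_Q_mul_sliceProj, ← Complex.coe_smul]; push_cast; rfl
  rw [cfc_mul_of_mul_eq_smul hsa' he (hf.continuous k), hf.apply_pow hq]
  split_ifs with h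
  · rw [h, one_smul, sliceProj_mul_self]
  · rw [zero_smul, sliceProj_mul_of_ne (Ne.symm h)]

/-! ### Unitaries that implement the gauge action -/

theorem norm_circle_pow_le (z : Circle) (k : ℕ) : ‖(z : ℂ) ^ k‖ ≤ 1 := by
  rw [norm_pow, Circle.norm_coe, one_pow]

/-- The unitary `e_k ↦ z ^ k e_k` on `ℓ²(ℕ)`. -/
def rotation (z : Circle) : EllTwo →L[ℂ] EllTwo :=
  diag (fun k => (z : ℂ) ^ k) (norm_circle_pow_le z)

theorem star_rotation (z : Circle) : star (rotation z) = rotation z⁻¹ := by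
  ext1 x
  refine lp.ext (funext fun k => ?_)
  rw [star_apply, rotation, diag_single, lp.inner_single_left, rotation, diag_apply]
  rw [RCLike.inner_apply, map_pow, Circle.coe_inv_eq_conj, mul_comm]

theorem rotation_mul_rotation_inv (z : Circle) : rotation z * rotation z⁻¹ = 1 := by
  ext1 x
  refine lp.ext (funext fun k => ?_)
  rw [mul_apply_eq_comp, rotation, rotation, diag_apply, diag_apply, ← mul_assoc, ← mul_pow,
    ← Circle.coe_mul, mul_inv_cancel]
  simp

theorem rotation_mul_weightedShift {q : ℝ} (hq : q ∈ Set.Ioo (0 : ℝ) 1) (z : Circle) :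
    rotation z⁻¹ * (S * opSqrt (1 - Q hq ^ 2)) =
      (z : ℂ) • (S * opSqrt (1 - Q hq ^ 2) * rotation z⁻¹) := by
  rw [sqrt_one_sub_sq]
  ext1 x
  refine lp.ext (funext fun k => ?_)
  simp only [mul_apply_eq_comp, smul_apply, lp.coeFn_smul, Pi.smul_apply, smul_eq_mul, diag_apply,
    rotation, S_apply, pow_succ, Circle.coe_inv]
  field_simp [Circle.coe_ne_zero z]

theorem rotation_mul_Q {q : ℝ} (hq : q ∈ Set.Ioo (0 : ℝ) 1) (z : Circle) :
    rotation z * Q hq = Q hq * rotation z := by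
  ext1 x
  refine lp.ext (funext fun k => ?_)
  simp only [mul_apply_eq_comp, Q, rotation, diag_apply, mul_left_comm]

/-- The translation `f ↦ f (· + y)` on `L²(ℝ)`. -/
def translation (y : ℝ) : LTwo →L[ℂ] LTwo :=
  (Lp.compMeasurePreservingₗᵢ ℂ (· + y)
    (measurePreserving_add_right volume y)).toContinuousLinearMap

theorem coeFn_translation (y : ℝ) (f : LTwo) : translation y f =ᵐ[volume] fun x => f (x + y) :=
  Lp.coeFn_compMeasurePreserving f (measurePreserving_add_right volume y)

theorem star_translation_mul (y : ℝ) : star (translation y) * translation y = 1 :=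
  (ContinuousLinearMap.norm_map_iff_adjoint_comp_self _).1 (LinearIsometry.norm_map _)

theorem ae_comp_add (y : ℝ) {p : ℝ → Prop} (h : ∀ᵐ x, p x) : ∀ᵐ x : ℝ, p (x + y) :=
  (measurePreserving_add_right volume y).quasiMeasurePreserving.ae h

theorem translation_mul_translation_neg (y : ℝ) : translation y * translation (-y) = 1 := by
  ext1 f
  refine Lp.ext ?_
  filter_upwards [coeFn_translation y (translation (-y) f),
    ae_comp_add y (coeFn_translation (-y) f)] with x h1 h2
  rw [mul_apply_eq_comp, h1, h2, add_neg_cancel_right]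
  rfl

theorem translation_mul_star (y : ℝ) : translation y * star (translation y) = 1 := by
  rw [left_inv_eq_right_inv (star_translation_mul y) (translation_mul_translation_neg y),
    translation_mul_translation_neg]

theorem translation_mul_phaseMul (y t : ℝ) :
    translation y * phaseMul t = phase t y • (phaseMul t * translation y) := by
  ext1 f
  refine Lp.ext ?_
  filter_upwards [coeFn_translation y (phaseMul t f), ae_comp_add y (coeFn_phaseMul t f),
    coeFn_phaseMul t (translation y f), coeFn_translation y f,
    Lp.coeFn_smul (phase t y) (phaseMul t (translation y f))] with x h1 h2 h3 h4 h5
  rw [mul_apply_eq_comp, h1, h2, smul_apply, mul_apply_eq_comp, h5, Pi.smul_apply, h3, h4,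
    smul_eq_mul, ← mul_assoc, phase, phase, phase, ← Complex.exp_add]
  push_cast
  ring_nf

theorem tens_smul_right (c : ℂ) (A : EllTwo →L[ℂ] EllTwo) (B : LTwo →L[ℂ] LTwo) :
    tens A (c • B) = c • tens A B :=
  ext_of fun x => by
    rw [smul_apply, tens_of, tens_of, TensorProduct.mapL_smul_right, smul_apply, map_smul]

/-- The unitary that multiplies `α` by `z` and `β` by `exp (2 π i t y)` under conjugation, in the
representation with `β ↦ Q ⊗ U`, `U` the multiplication by `x ↦ exp (2 π i t x)`. -/
def gaugeUnitary (z : Circle) (y : ℝ) : unitary (Hilb →L[ℂ] Hilb) :=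
  ⟨tens (rotation z⁻¹) (translation y), by
    rw [Unitary.mem_iff, star_tens, tens_mul, tens_mul, star_rotation, inv_inv,
      rotation_mul_rotation_inv, star_translation_mul, translation_mul_star, tens_one]
    refine ⟨rfl, ?_⟩
    have := rotation_mul_rotation_inv z⁻¹
    rw [inv_inv] at this
    rw [this, tens_one]⟩

/-- Conjugation by a unitary, as a *-homomorphism. -/
def conjHom {R : Type*} [CStarAlgebra R] (u : unitary R) : R →⋆ₐ[ℂ] R :=
  (Unitary.conjStarAlgAut ℂ R u).toStarAlgHom

theorem mul_mul_star_of_mul_eq_smul {R : Type*} [Ring R] [StarRing R] [Algebra ℂ R]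
    (u : unitary R) {x : R} {c : ℂ} (h : (u : R) * x = c • (x * u)) :
    (u : R) * x * star (u : R) = c • x := by
  rw [h, smul_mul_assoc, mul_assoc, Unitary.mul_star_self_of_mem u.2, mul_one]

/-- For `t ≠ 0` the gauge action on the represented algebra is implemented by unitaries. -/
theorem exists_gauge_phaseRep {q : ℝ} (hq : q ∈ Set.Ioo (0 : ℝ) 1) {t : ℝ} (ht : t ≠ 0)
    (s : Torus) : ∃ u : unitary (Hilb →L[ℂ] Hilb), ∀ x : CSUq q,
      gauge (relations_tens hq t) x s =
        (u : Hilb →L[ℂ] Hilb) * phaseRep hq t x * star (u : Hilb →L[ℂ] Hilb) := by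
  obtain ⟨s₁, s₂⟩ := s
  obtain ⟨r, rfl⟩ := QuotientAddGroup.mk_surjective s₂
  -- with this translation length the factor `exp (2 π i t (r / t))` is `exp (2 π i r)`
  let u := gaugeUnitary (AddCircle.toCircle s₁) (r / t)
  refine ⟨u, fun x => ?_⟩
  let φ : CSUq q →⋆ₐ[ℂ] (Hilb →L[ℂ] Hilb) :=
    (conjHom u).comp (phaseRep hq t)
  have hφ : ∀ x, φ x = (u : Hilb →L[ℂ] Hilb) * phaseRep hq t x * star (u : Hilb →L[ℂ] Hilb) :=
    fun _ => rfl
  rw [← hφ]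
  refine gauge_apply _ _ ?_ ?_ x
  · rw [hφ, phaseRep, lift_alpha]
    refine mul_mul_star_of_mul_eq_smul u ?_
    simp only [u, gaugeUnitary]
    rw [tens_mul, tens_mul, rotation_mul_weightedShift, mul_one, one_mul, tens_smul_left,
      fourier_one]
  · rw [hφ, phaseRep, lift_beta]
    refine mul_mul_star_of_mul_eq_smul u ?_
    simp only [u, gaugeUnitary]
    rw [tens_mul, tens_mul, rotation_mul_Q, translation_mul_phaseMul, tens_smul_right]
    congr 1
    refine Eq.trans ?_ (fourier_coe_apply (T := 1) (n := 1) (x := r)).symm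
    rw [phase]
    congr 1
    push_cast
    field_simp [Complex.ofReal_ne_zero.2 ht]

/-! ### Faithfulness of the representations -/

theorem aeval_mul_of_mul_eq_smul {R : Type*} [Ring R] [Algebra ℂ R] {x e : R} {c : ℂ}
    (h : x * e = c • e) (P : ℂ[X]) : Polynomial.aeval x P * e = P.eval c • e := by
  induction P using Polynomial.induction_on' with
  | add P R hP hR => rw [map_add, add_mul, hP, hR, Polynomial.eval_add, add_smul]
  | monomial n r =>
    have hn : x ^ n * e = c ^ n • e := by
      induction n with
      | zero => simp
      | succ n ih => rw [pow_succ, mul_assoc, h, mul_smul_comm, ih, smul_smul, pow_succ']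
    rw [Polynomial.aeval_monomial, Polynomial.eval_monomial, Algebra.algebraMap_eq_smul_one,
      smul_mul_assoc, one_mul, smul_mul_assoc, hn, mul_smul]

/-- Among all pairs that satisfy the relations, polynomials in `b b*` have the largest norm at
`b b* = Q² ⊗ 1`, which has all powers of `q²` as eigenvalues. -/
theorem Relations.norm_aeval_le {q : ℝ} (hq : q ∈ Set.Ioo (0 : ℝ) 1) {B : Type*} [CStarAlgebra B]
    {a b : B} (h : Relations q a b) (P : ℂ[X]) :
    ‖Polynomial.aeval (b * star b) P‖ ≤ ‖Polynomial.aeval (tens (Q hq * Q hq) 1) P‖ := by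
  have hn : IsStarNormal (b * star b) := (IsSelfAdjoint.mul_star_self b).isStarNormal
  rw [← cfc_polynomial P (b * star b)]
  refine norm_cfc_le (norm_nonneg _) fun z hz => ?_
  have hcl : IsClosed {z : ℂ | ‖P.eval z‖ ≤ ‖Polynomial.aeval (tens (Q hq * Q hq) 1) P‖} :=
    isClosed_le (by fun_prop) continuous_const
  refine closure_minimal ?_ hcl (h.spectrum_subset hq hz)
  rintro _ ⟨k, rfl⟩
  have h1 := norm_mul_le (Polynomial.aeval (tens (Q hq * Q hq) 1) P) (sliceProj k)
  rw [aeval_mul_of_mul_eq_smul (tens_Q_mul_sliceProj hq k), norm_smul] at h1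
  exact le_of_mul_le_mul_right h1 (norm_pos_iff.2 (sliceProj_ne_zero k))

/-- Among all pairs that satisfy the relations, means have the largest norm at
`(S √(1 - Q²) ⊗ 1, Q ⊗ U)`. -/
theorem norm_average_le_norm_average_phaseRep {q : ℝ} (hq : q ∈ Set.Ioo (0 : ℝ) 1) (t : ℝ)
    {B : Type} [CStarAlgebra B] {a b : B} (h : Relations q a b) (x : CSUq q) :
    ‖average h x‖ ≤ ‖average (relations_tens hq t) x‖ := by
  have hcl : IsClosed {x : CSUq q | ‖average h x‖ ≤ ‖average (relations_tens hq t) x‖} :=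
    isClosed_le (continuous_average h).norm (continuous_average _).norm
  refine hcl.closure_subset_iff.2 ?_ (adjoin_alpha_beta_dense q x)
  intro y hy
  obtain ⟨P, hP⟩ := exists_average_eq_aeval ((relations q).adjoin_le_span hq hy)
  rw [Set.mem_ofPred_eq, hP _ _ _ h, hP _ _ _ (relations_tens hq t), tens_Q_mul_star]
  exact h.norm_aeval_le hq P

/-- The representations with `t ≠ 0` are faithful. An element `x` of the kernel has an orbit in the
kernel, so the mean of `x* x` vanishes in the representation; it then vanishes at every realization
of the relations, where averaging is faithful. -/
theorem phaseRep_injective {q : ℝ} (hq : q ∈ Set.Ioo (0 : ℝ) 1) {t : ℝ} (ht : t ≠ 0) :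
    Function.Injective (phaseRep hq t) := by
  refine (injective_iff_map_eq_zero _).2 fun x hx => ?_
  refine Subtype.ext (lp.ext (funext fun i => ?_))
  have hzero : average (relations_tens hq t) (star x * x) = 0 := by
    refine (integral_congr_ae (.of_forall fun s => ?_)).trans (integral_zero _ _)
    obtain ⟨u, hu⟩ := exists_gauge_phaseRep hq ht s
    rw [hu, map_mul, hx, mul_zero, mul_zero, zero_mul]
  have havg : average i.rel (star x * x) = 0 := by
    have := norm_average_le_norm_average_phaseRep hq t i.rel (star x * x)
    rwa [hzero, norm_zero, norm_le_zero_iff] at this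
  have hg : gauge i.rel x = 0 := by
    refine eq_zero_of_integral_star_mul_self_eq_zero torusMeasure _ ?_
    simpa only [average, map_mul, map_star] using havg
  -- at the neutral element of the torus the gauge action is trivial
  have h0 : gauge i.rel x 0 = eval i x :=
    gauge_apply _ _ (by simp [show eval i (alpha q) = i.a from rfl])
      (by simp [show eval i (beta q) = i.b from rfl]) x
  rw [hg] at h0
  exact h0.symm

/-! ### Series of slices and generators of the covering algebra -/

theorem norm_tens_coordProj_le {B : LTwo →L[ℂ] LTwo} (hB : star B * B = 1) (k : ℕ) :
    ‖tens (coordProj k) B‖ ≤ 1 := by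
  have h := CStarRing.norm_star_mul_self (x := tens (coordProj k) B)
  rw [star_tens, tens_mul, hB, star_coordProj, coordProj_mul_self] at h
  have h1 := h.symm.trans_le (norm_sliceProj_le k)
  nlinarith [norm_nonneg (tens (coordProj k) B)]

theorem summable_pow_smul_tens {r : ℝ} (hr : r ∈ Set.Ioo (0 : ℝ) 1) {B : LTwo →L[ℂ] LTwo}
    (hB : star B * B = 1) : Summable fun k : ℕ => ((r ^ k : ℝ) : ℂ) • tens (coordProj k) B := by
  refine .of_norm_bounded (summable_geometric_of_lt_one hr.1.le hr.2) fun k => ?_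
  rw [norm_smul, Complex.norm_real, Real.norm_of_nonneg (pow_nonneg hr.1.le k)]
  exact mul_le_of_le_one_right (pow_nonneg hr.1.le k) (norm_tens_coordProj_le hB k)

theorem tsum_pow_smul_tens {r : ℝ} (hr : r ∈ Set.Ioo (0 : ℝ) 1) {B : LTwo →L[ℂ] LTwo}
    (hB : star B * B = 1) :
    ∑' k : ℕ, ((r ^ k : ℝ) : ℂ) • tens (coordProj k) B = tens (Q hr) B := by
  refine ext_sliceProj fun j => ?_
  rw [← (summable_pow_smul_tens hr hB).tsum_mul_right, tsum_eq_single j, sliceProj, smul_mul_assoc,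
    tens_mul, tens_mul, coordProj_mul_self, Q_mul_coordProj, tens_smul_left]
  · push_cast; rfl
  · intro k hk
    rw [sliceProj, smul_mul_assoc, tens_mul, coordProj_mul_of_ne hk, tens_zero_left, smul_zero]

/-- A closed *-algebra of operators that contains the projections onto the copies of `L²(ℝ)` and one
of the operators `Q_r ⊗ B`, where `Q_r e_k = r ^ k e_k`, contains all of them, with
`r` replaced by any other base and `B` by any of its positive powers. -/
theorem tens_Q_mem {r s : ℝ} (hr : r ∈ Set.Ioo (0 : ℝ) 1) (hs : s ∈ Set.Ioo (0 : ℝ) 1)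
    {B : LTwo →L[ℂ] LTwo} (hB : star B * B = 1) {A : StarSubalgebra ℂ (Hilb →L[ℂ] Hilb)}
    (hA : IsClosed (A : Set (Hilb →L[ℂ] Hilb))) (hproj : ∀ k, sliceProj k ∈ A)
    (hmem : tens (Q hr) B ∈ A) {n : ℕ} (hn : 1 ≤ n) : tens (Q hs) (B ^ n) ∈ A := by
  have hslice : ∀ k, tens (coordProj k) B ∈ A := by
    intro k
    have h := A.smul_mem (mul_mem hmem (hproj k)) (((r : ℂ) ^ k)⁻¹)
    rwa [sliceProj, tens_mul, Q_mul_coordProj, tens_smul_left, mul_one,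
      inv_smul_smul₀ (pow_ne_zero k (Complex.ofReal_ne_zero.2 hr.1.ne'))] at h
  have hpow : ∀ m k, tens (coordProj k) (B ^ (m + 1)) = tens (coordProj k) B ^ (m + 1) := by
    intro m k
    induction m with
    | zero => simp
    | succ m ih => rw [pow_succ (tens _ _), ← ih, tens_mul, coordProj_mul_self, ← pow_succ]
  have hBn : star (B ^ n) * B ^ n = 1 := by
    rw [star_pow]
    exact pow_mul_pow_eq_one n hB
  rw [← tsum_pow_smul_tens hs hBn]
  refine hA.mem_of_tendsto (summable_pow_smul_tens hs hBn).hasSum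
    (.of_forall fun t => sum_mem fun k _ => A.smul_mem ?_ _)
  obtain ⟨m, rfl⟩ := Nat.exists_eq_add_of_le' hn
  rw [hpow]
  exact pow_mem (hslice k) _

theorem map_mem_of_generators_mem {q : ℝ} {B : Type*} [CStarAlgebra B] (φ : CSUq q →⋆ₐ[ℂ] B)
    {A : StarSubalgebra ℂ B} (hA : IsClosed (A : Set B)) (ha : φ (alpha q) ∈ A)
    (hb : φ (beta q) ∈ A) (x : CSUq q) : φ x ∈ A := by
  have hφ : Continuous φ := map_continuous φ
  refine (hA.preimage hφ).closure_subset_iff.2 ?_ (adjoin_alpha_beta_dense q x)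
  have : StarAlgebra.adjoin ℂ {alpha q, beta q} ≤ A.comap φ := by
    refine StarAlgebra.adjoin_le ?_
    rintro _ (rfl | rfl)
    · exact ha
    · exact hb
  exact this

theorem phaseMul_pow (t : ℝ) (n : ℕ) : phaseMul t ^ n = phaseMul (n * t) := by
  induction n with
  | zero => simp [phaseMul_zero]
  | succ n ih => rw [pow_succ, ih, phaseMul_mul]; push_cast; ring_nf

theorem projTensRoot_eq {q : ℝ} (hq : q ∈ Set.Ioo (0 : ℝ) 1) (n : ℕ) {f : ℕ → ℝ → ℝ}
    (hf : IsBumpFamily q f) (k : ℕ) :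
    projTensRoot hq n f k = tens (coordProj k) (phaseMul (1 / n)) := by
  rw [projTensRoot, show rep hq = phaseRep hq 1 from rfl, phaseRep_specProj hq 1 hf, sliceProj,
    tens_mul, mul_one, one_mul]

theorem rpow_one_div_mem {q : ℝ} (hq : q ∈ Set.Ioo (0 : ℝ) 1) {n : ℕ} (hn : 1 ≤ n) :
    q ^ (1 / n : ℝ) ∈ Set.Ioo (0 : ℝ) 1 :=
  ⟨Real.rpow_pos_of_pos hq.1 _, Real.rpow_lt_one hq.1.le hq.2 (by positivity)⟩

end

end QuantumSU2

open QuantumSU2 in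
theorem mainTheorem4 (q : ℝ) (hq : q ∈ Set.Ioo (0 : ℝ) 1) (n : ℕ) (hn : 1 ≤ n)
    (f : ℕ → ℝ → ℝ) (hf : QuantumSU2.IsBumpFamily q f) :
    Summable (QuantumSU2.betaTildeTerm hq n f) ∧
    Summable (QuantumSU2.betaTildeTildeTerm hq n f) ∧
    QuantumSU2.betaTildeTilde hq n f ∈ QuantumSU2.coveringAlgebra hq n f ∧
    QuantumSU2.Relations q (QuantumSU2.rep hq (QuantumSU2.alpha q))
      (QuantumSU2.betaTildeTilde hq n f) ∧
    ∃! φ : QuantumSU2.CSUq q ≃⋆ₐ[ℂ] QuantumSU2.coveringAlgebra hq n f,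
      (φ (QuantumSU2.alpha q) : QuantumSU2.Hilb →L[ℂ] QuantumSU2.Hilb) =
        QuantumSU2.rep hq (QuantumSU2.alpha q) ∧
      (φ (QuantumSU2.beta q) : QuantumSU2.Hilb →L[ℂ] QuantumSU2.Hilb) =
        QuantumSU2.betaTildeTilde hq n f := by
  have hr := rpow_one_div_mem hq hn
  have hn0 : (n : ℝ) ≠ 0 := by positivity
  set B := phaseMul (1 / n) with hBdef
  have hB : star B * B = 1 := star_phaseMul_mul _
  have hterm : betaTildeTerm hq n f =
      fun k => (((q ^ (1 / n : ℝ)) ^ k : ℝ) : ℂ) • tens (coordProj k) B :=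
    funext fun k => by rw [betaTildeTerm, projTensRoot_eq hq n hf]
  have hterm' : betaTildeTildeTerm hq n f = fun k => ((q ^ k : ℝ) : ℂ) • tens (coordProj k) B :=
    funext fun k => by rw [betaTildeTildeTerm, projTensRoot_eq hq n hf]
  have htilde : betaTilde hq n f = tens (Q hr) B := by
    rw [betaTilde, hterm, tsum_pow_smul_tens hr hB]
  have htilde' : betaTildeTilde hq n f = tens (Q hq) B := by
    rw [betaTildeTilde, hterm', tsum_pow_smul_tens hq hB]
  have hclosed : IsClosed (coveringAlgebra hq n f : Set (Hilb →L[ℂ] Hilb)) :=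
    StarSubalgebra.isClosed_topologicalClosure _
  have hrep : ∀ x, rep hq x ∈ coveringAlgebra hq n f := fun x =>
    StarSubalgebra.le_topologicalClosure _ (StarAlgebra.subset_adjoin ℂ _ (.inl ⟨x, rfl⟩))
  have hmem : tens (Q hr) B ∈ coveringAlgebra hq n f :=
    StarSubalgebra.le_topologicalClosure _ (StarAlgebra.subset_adjoin ℂ _ (.inr htilde.symm))
  have hmem' : tens (Q hq) B ∈ coveringAlgebra hq n f := by
    simpa using tens_Q_mem hr hq hB hclosed
      (fun k => phaseRep_specProj hq 1 hf k ▸ hrep (specProj q f k)) hmem le_rfl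
  -- The range of `ψ` is the covering algebra.
  let ψ := phaseRep hq (1 / n)
  have hψa : ψ (alpha q) = rep hq (alpha q) := (lift_alpha _).trans (lift_alpha _).symm
  have hψb : ψ (beta q) = tens (Q hq) B := lift_beta _
  have hψinj : Function.Injective ψ := phaseRep_injective hq (one_div_ne_zero hn0)
  have hψmem : ∀ x, ψ x ∈ coveringAlgebra hq n f :=
    map_mem_of_generators_mem ψ hclosed (hψa ▸ hrep _) (hψb ▸ hmem')
  have hψclosed : IsClosed (ψ.range : Set (Hilb →L[ℂ] Hilb)) :=
    (NonUnitalStarAlgHom.isometry ψ hψinj).isClosedEmbedding.isClosed_range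
  have hψproj : ∀ k, sliceProj k ∈ ψ.range := fun k => ⟨_, phaseRep_specProj hq (1 / n) hf k⟩
  have hψrange : coveringAlgebra hq n f ≤ ψ.range := by
    refine StarSubalgebra.topologicalClosure_minimal (StarAlgebra.adjoin_le ?_) hψclosed
    rintro _ (⟨x, rfl⟩ | rfl)
    · -- `Q ⊗ R` is obtained from `Q ⊗ R^{1/n}` by taking the `n`-th power of the phase
      refine map_mem_of_generators_mem (rep hq) hψclosed ⟨_, hψa⟩ ?_ x
      rw [rep_beta]
      have h := tens_Q_mem hq hq hB hψclosed hψproj ⟨_, hψb⟩ hn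
      rwa [hBdef, phaseMul_pow, mul_one_div_cancel hn0] at h
    · rw [htilde]
      simpa using tens_Q_mem hq hr hB hψclosed hψproj ⟨_, hψb⟩ le_rfl
  refine ⟨hterm ▸ summable_pow_smul_tens hr hB, hterm' ▸ summable_pow_smul_tens hq hB,
    htilde' ▸ hmem', ?_, ?_⟩
  · rw [htilde', rep_alpha]
    exact relations_tens hq _
  · refine ⟨.ofBijective (ψ.codRestrict _ hψmem) ⟨?_, ?_⟩, ⟨hψa, hψb.trans htilde'.symm⟩, ?_⟩
    · exact fun x y h => hψinj (congrArg Subtype.val h)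
    · rintro ⟨y, hy⟩
      obtain ⟨x, hx⟩ := hψrange hy
      exact ⟨x, Subtype.ext hx⟩
    · rintro φ ⟨hφa, hφb⟩
      have key : (coveringAlgebra hq n f).subtype.comp φ.toStarAlgHom = ψ :=
        hom_ext (hφa.trans hψa.symm) (hφb.trans (htilde'.trans hψb.symm))
      exact StarAlgEquiv.ext fun x => Subtype.ext (congrArg (fun g => g x) key)
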